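/- Conventions. All spaces are Tychonoff. $G$ is a (Hausdorff) topological group, and a $G$-space is a Tychonoff space $X$ with a (jointly) continuous left action of $G$. $C(X)$ is the Banach algebra of bounded continuous functions $X\to\mathbb R$ with the supremum norm, and $(fg)(x):=f(gx)$ for $f\in C(X)$, $g\in G$, $x\in X$. A $G$-subalgebra is a uniformly closed subalgebra of $C(X)$ that contains the constants and is invariant under $f\mapsto fg$ for all $g\in G$. A $G$-compactification of $X$ is a continuous $G$-map $\nu:X\to Y$ with dense image into a compact (Hausdorff) $G$-space $Y$; a function $f\in C(X)$ comes from $Y$ if $f=F\circ\nu$ for some such $\nu$ and some continuous $F:Y\to\mathbb R$. For a $G$-subalgebra $\mathcal A$ let $|\mathcal A|$ be its Gelfand space (nonzero multiplicative continuous linear functionals, weak-star topology) with the action $(g\varphi)(f):=\varphi(fg)$ and the map $\nu_{\mathcal A}:X\to|\mathcal A|$, $x\mapsto(f\mapsto f(x))$. Call a compact $G$-space $Y$, with its unique compatible uniformity $\mu$: - SUC if for all $x_0\in Y$ and $\varepsilon\in\mu$ there is a neighbourhood $U$ of $e\in G$ with $(gux_0,gx_0)\in\varepsilon$ for all $g\in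 G$, $u\in U$; - LE if every $x_0\in Y$ is a point of equicontinuity of $\overline{Gx_0}$, that is, for every $\varepsilon\in\mu$ there is a neighbourhood $O$ of $x_0$ with $(gx_0,gx)\in\varepsilon$ for all $g\in G$ and $x\in O\cap\overline{Gx_0}$; - HNS if for every nonempty closed $G$-invariant $Z\subset Y$ and every $\varepsilon\in\mu$ there is a nonempty relatively open $O\subset Z$ with $gO\times gO\subset\varepsilon$ for all $g\in G$. Let $RUC(X)$ be the set of $f\in C(X)$ for which $G\to C(X)$, $g\mapsto fg$, is norm continuous; let $SUC(X)$, $LE(X)$, $Asp(X)$ be the sets of functions that come from an SUC, LE, HNS compact $G$-space, respectively; let $WAP(X)$ (respectively $AP(X)$) be the set of $f\in C(X)$ whose orbit $\{fg: g\in G\}$ is relatively weakly compact (respectively relatively norm compact) in $C(X)$. For $X=G$ with the action by left multiplication let $UC(G)=RUC(G)\cap LUC(G)$, where $LUC(G)$ is the set of $f\in C(G)$ for which $g\mapsto f(\,\cdot\,g)$ is norm continuous. Theorem. (1) For every (not necessarily compact) $G$-space $X$ there is a chain of inclusions of $G$-subalgebras $$RUC(X)\supset SUC(X)\supset LE(X)\supset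 Asp(X)\supset WAP(X)\supset AP(X).$$ For each member $\mathcal A$ of the chain, $\nu_{\mathcal A}:X\to X^{\mathcal A}:=|\mathcal A|$ is a $G$-compactification, and, with $\beta_GX:=|RUC(X)|$, there is a corresponding chain of $G$-factor maps $$\beta_GX\to X^{SUC}\to X^{LE}\to X^{Asp}\to X^{WAP}\to X^{AP};$$ that is, for consecutive $\mathcal A\supset\mathcal B$ there is exactly one continuous surjective $G$-map $\alpha:|\mathcal A|\to|\mathcal B|$ with $\alpha\circ\nu_{\mathcal A}=\nu_{\mathcal B}$. (2) For every topological group $G$, with $X=G$, there is likewise a chain of inclusions of $G$-subalgebras $$RUC(G)\supset UC(G)\supset SUC(G)\supset LE(G)\supset Asp(G)\supset WAP(G)\supset AP(G),$$ whose Gelfand spaces are $G$-compactifications of $G$, and, in the same sense, a corresponding chain of $G$-factor maps $$G^{RUC}\to G^{UC}\to G^{SUC}\to G^{LE}\to G^{Asp}\to G^{WAP}\to G^{AP}.$$ -/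

import Mathlib

open Set Filter Topology Uniformity
open scoped BoundedContinuousFunction

universe u v

namespace GSystem

section Functions

variable (G : Type v) [Group G] {X : Type u} [TopologicalSpace X] [MulAction G X]

/-- The right action of `G` on bounded continuous functions: `(f g)(x) = f (g x)`. -/
def translate {G : Type v} [Group G] {X : Type u} [TopologicalSpace X] [MulAction G X]
    [ContinuousConstSMul G X] (f : X →ᵇ ℝ) (g : G) : X →ᵇ ℝ :=
  f.compContinuous ⟨fun x => g • x, continuous_const_smul g⟩

@[simp] theorem translate_apply [ContinuousConstSMul G X] (f : X →ᵇ ℝ) (g : G) (x : X) :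
    translate f g x = f (g • x) := rfl

/-- `ν : X → Y` is a `G`-compactification of `X`: a continuous `G`-map with dense range into a
compact Hausdorff space `Y` on which `G` acts (jointly) continuously. -/
structure IsGCompactification [TopologicalSpace G] {Y : Type*} [TopologicalSpace Y]
    [MulAction G Y] (ν : X → Y) : Prop where
  compact : CompactSpace Y
  t2 : T2Space Y
  continuousSMul : ContinuousSMul G Y
  continuous : Continuous ν
  denseRange : DenseRange ν
  map_smul : ∀ (g : G) (x : X), ν (g • x) = g • ν x

end Functions

section Systems

variable (G : Type v) [Group G] (Y : Type u) [UniformSpace Y] [MulAction G Y]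

/-- Strong uniform continuity: every orbit map `g ↦ g x₀` is uniformly continuous for the left
uniformity of `G`. -/
def IsSUC [TopologicalSpace G] : Prop :=
  ∀ x₀ : Y, ∀ ε ∈ 𝓤 Y, ∃ U ∈ 𝓝 (1 : G), ∀ g : G, ∀ u ∈ U, ((g * u) • x₀, g • x₀) ∈ ε

/-- Local equicontinuity: every point `x₀` is a point of equicontinuity of the `G`-subspace
`cl (G x₀)`. -/
def IsLE : Prop :=
  ∀ x₀ : Y, EquicontinuousWithinAt (fun (g : G) (y : Y) => g • y)
    (closure (MulAction.orbit G x₀)) x₀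

/-- The `G`-subspace `Z` is sensitive: for some entourage `ε`, every nonempty relatively open
subset of `Z` has a translate that is not `ε`-small. -/
def IsSensitiveOn {Y : Type u} [UniformSpace Y] [MulAction G Y] (Z : Set Y) : Prop :=
  ∃ ε ∈ 𝓤 Y, ∀ O : Set Y, IsOpen O → (O ∩ Z).Nonempty →
    ∃ g : G, ∃ x ∈ O ∩ Z, ∃ y ∈ O ∩ Z, (g • x, g • y) ∉ ε

/-- Hereditary non-sensitivity: no nonempty closed `G`-subspace is sensitive. -/
def IsHNS : Prop :=
  ∀ Z : Set Y, IsClosed Z → Z.Nonempty → (∀ (g : G), ∀ z ∈ Z, g • z ∈ Z) →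
    ¬ IsSensitiveOn G Z

end Systems

section Classes

variable (G : Type v) [Group G] [TopologicalSpace G]
variable (X : Type u) [TopologicalSpace X] [MulAction G X]

/-- The functions on `X` that come from a compact `G`-system in the class `P`. A compact Hausdorff
space carries exactly one compatible uniformity, so ranging over compact Hausdorff uniform spaces
is ranging over compact Hausdorff spaces; since a compactification of `X` has a dense image of
`X`, it may always be taken in the universe of `X`. -/
def comingFrom (P : ∀ (Y : Type u) [UniformSpace Y] [MulAction G Y], Prop) : Set (X →ᵇ ℝ) :=
  {f | ∃ (Y : Type u) (_ : UniformSpace Y) (_ : MulAction G Y) (ν : X → Y) (F : C(Y, ℝ)),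
    IsGCompactification G ν ∧ P Y ∧ ∀ x, f x = F (ν x)}

/-- Strongly uniformly continuous functions. -/
def SUC : Set (X →ᵇ ℝ) := comingFrom G X (fun Y _ _ => IsSUC G Y)

/-- Locally equicontinuous functions. -/
def LE : Set (X →ᵇ ℝ) := comingFrom G X (fun Y _ _ => IsLE G Y)

/-- Asplund functions. -/
def Asp : Set (X →ᵇ ℝ) := comingFrom G X (fun Y _ _ => IsHNS G Y)

/-- Right uniformly continuous functions: the orbit map `g ↦ f g` is norm continuous. -/
def RUC [ContinuousConstSMul G X] : Set (X →ᵇ ℝ) :=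
  {f | Continuous fun g : G => translate f g}

/-- Weakly almost periodic functions: the orbit `f G` is relatively weakly compact. -/
def WAP [ContinuousConstSMul G X] : Set (X →ᵇ ℝ) :=
  {f | IsCompact (closure (toWeakSpace ℝ (X →ᵇ ℝ) '' range fun g : G => translate f g))}

/-- Almost periodic functions: the orbit `f G` is relatively norm compact. -/
def AP [ContinuousConstSMul G X] : Set (X →ᵇ ℝ) :=
  {f | IsCompact (closure (range fun g : G => translate f g))}

/-- Left uniformly continuous functions on a group: the orbit map `g ↦ g f` of the right
translations `(g f)(x) = f (x g)` is norm continuous. -/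
def LUC [ContinuousMul G] : Set (G →ᵇ ℝ) :=
  {f | Continuous fun g : G => f.compContinuous ⟨fun x => x * g, continuous_mul_const g⟩}

/-- `UC(G) = RUC(G) ∩ LUC(G)`, with `G` acting on itself by left multiplication. -/
def UC [ContinuousMul G] : Set (G →ᵇ ℝ) := RUC G G ∩ LUC G

end Classes

section Algebras

variable (G : Type v) [Group G] (X : Type u) [TopologicalSpace X] [MulAction G X]
  [ContinuousConstSMul G X]

/-- `G`-subalgebras: uniformly closed, unital, `G`-invariant subalgebras of the algebra of bounded
continuous real functions on `X`. -/
structure GSubalgebra extends Subalgebra ℝ (X →ᵇ ℝ) where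
  isClosed' : IsClosed carrier
  translate_mem' : ∀ f ∈ carrier, ∀ g : G, translate f g ∈ carrier

variable {G X}

/-- The underlying set of functions of a `G`-subalgebra. -/
def GSubalgebra.functions (A : GSubalgebra G X) : Set (X →ᵇ ℝ) := A.carrier

/-- The Gelfand space `|A|` of a `G`-subalgebra: its nonzero multiplicative continuous linear
functionals, with the weak star topology. -/
abbrev GSubalgebra.Gelfand (A : GSubalgebra G X) : Type u :=
  WeakDual.characterSpace ℝ A.toSubalgebra

/-- Translation by `g`, as a linear map of a `G`-subalgebra to itself. -/
def GSubalgebra.translateLM (A : GSubalgebra G X) (g : G) :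
    A.toSubalgebra →ₗ[ℝ] A.toSubalgebra where
  toFun f := ⟨translate f.1 g, A.translate_mem' f.1 f.2 g⟩
  map_add' _ _ := rfl
  map_smul' _ _ := rfl

/-- Translation by `g`, as a continuous linear map of a `G`-subalgebra to itself. -/
noncomputable def GSubalgebra.translateL (A : GSubalgebra G X) (g : G) :
    A.toSubalgebra →L[ℝ] A.toSubalgebra where
  toLinearMap := A.translateLM g
  cont := Continuous.subtype_mk
    ((BoundedContinuousFunction.continuous_compContinuous _).comp continuous_subtype_val) _

@[simp] theorem GSubalgebra.translateL_coe (A : GSubalgebra G X) (g : G) (f : A.toSubalgebra) :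
    (A.translateL g f : X →ᵇ ℝ) = translate (f : X →ᵇ ℝ) g := rfl

/-- The natural action on the Gelfand space: `(g φ)(f) = φ (f g)`. -/
noncomputable instance GSubalgebra.instSMulGelfand (A : GSubalgebra G X) : SMul G A.Gelfand where
  smul g φ := ⟨StrongDual.toWeakDual ((WeakDual.toStrongDual φ.1).comp (A.translateL g)), by
    constructor
    · intro h
      have h1 : φ (A.translateL g 1) = 0 := congrArg (fun ψ : WeakDual ℝ _ => ψ 1) h
      have h2 : A.translateL g 1 = 1 := rfl
      rw [h2, map_one] at h1
      exact one_ne_zero h1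
    · intro a b
      have h2 : A.translateL g (a * b) = A.translateL g a * A.translateL g b := rfl
      change φ (A.translateL g (a * b)) = φ (A.translateL g a) * φ (A.translateL g b)
      rw [h2, map_mul]⟩

theorem GSubalgebra.smul_apply (A : GSubalgebra G X) (g : G) (φ : A.Gelfand)
    (f : A.toSubalgebra) : (g • φ) f = φ (A.translateL g f) := rfl

noncomputable instance GSubalgebra.instMulActionGelfand (A : GSubalgebra G X) : MulAction G A.Gelfand where
  one_smul φ := by
    apply WeakDual.CharacterSpace.ext
    intro f
    rw [A.smul_apply]
    congr 1
    ext x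
    simp
  mul_smul g h φ := by
    apply WeakDual.CharacterSpace.ext
    intro f
    simp only [A.smul_apply]
    congr 1
    ext x
    simp [mul_smul]

/-- The natural map `X → |A|`, sending `x` to the evaluation at `x`. -/
noncomputable def GSubalgebra.eva (A : GSubalgebra G X) (x : X) : A.Gelfand :=
  ⟨StrongDual.toWeakDual
    ((BoundedContinuousFunction.evalCLM ℝ x).comp A.toSubalgebra.toSubmodule.subtypeL), by
    constructor
    · intro h
      have h1 : (1 : ℝ) = 0 := congrArg (fun ψ : WeakDual ℝ A.toSubalgebra => ψ 1) h
      exact one_ne_zero h1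
    · intro a b
      rfl⟩

theorem GSubalgebra.eva_apply (A : GSubalgebra G X) (x : X) (f : A.toSubalgebra) :
    A.eva x f = (f : X →ᵇ ℝ) x := rfl

/-- There is exactly one `G`-factor map `|A| → |B|` (a continuous surjective `G`-map) that is
compatible with the natural maps `X → |A|` and `X → |B|`. -/
def HasGFactorMap (A B : GSubalgebra G X) : Prop :=
  ∃! α : A.Gelfand → B.Gelfand, Continuous α ∧ Function.Surjective α ∧
    (∀ (g : G) (φ : A.Gelfand), α (g • φ) = g • α φ) ∧ ∀ x : X, α (A.eva x) = B.eva x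

end Algebras

end GSystem

/-! The engine is a fragmentation lemma, `exists_isOpen_small_oscillation`: for a separately
continuous function on a product T × M of compact spaces, every nonempty A ⊆ T has a relatively open
piece on which the oscillation is small uniformly over M. Otherwise a Cantor scheme in T would
produce uncountably many functions on M, pairwise ε-separated, yet all in the pointwise closure of
one countable family. Such functions factor through a compact metrizable K, and C(K) is separable.

The lemma is used three times for WAP. On |WAP(X)| × (weak closure of fG) it makes the Gelfand space
fragmented uniformly over G, hence HNS, so WAP ⊆ Asp. On the weak orbit closure, paired with
characters, it turns weak continuity of the orbit map into norm continuity, so WAP ⊆ RUC; this gives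
the joint continuity of the action on |WAP(X)|. Inside Grothendieck's theorem
(`continuous_of_forall_eval`) it shows that products of WAP functions are WAP.

The inclusions Asp ⊆ LE ⊆ SUC hold already for systems. An HNS system is fragmented on all subsets;
a small piece of the closure of Gx₀ meets the orbit, so the group carries it to x₀, which gives
equicontinuity there; and ux₀ → x₀ inside the orbit closure as u → e. The three classes defined by
systems give algebras because they are stable under subsystems of products. Finally, an inclusion of
algebras becomes a factor map by restricting characters. -/

namespace GSystem

/-! ### Fragmentation of separately continuous functions on compact products. -/

section Fragmentation

/-- The initial segments (in reversed order) of a binary sequence. -/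
def branch (σ : ℕ → Bool) : ℕ → List Bool
  | 0 => []
  | n + 1 => σ n :: branch σ n

/-- Two distinct branches of the Cantor scheme pass through a last common node; the test point
chosen at that node separates their limit points. -/
theorem exists_branch_split {σ τ : ℕ → Bool} (h : σ ≠ τ) :
    ∃ n, branch σ n = branch τ n ∧ σ n ≠ τ n := by
  have hex : ∃ n, σ n ≠ τ n := by
    by_contra! hc
    exact h (funext hc)
  classical
  refine ⟨Nat.find hex, ?_, Nat.find_spec hex⟩
  have hlt : ∀ k < Nat.find hex, σ k = τ k := fun k hk => not_not.1 (Nat.find_min hex hk)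
  generalize Nat.find hex = N at hlt
  induction N with
  | zero => rfl
  | succ N ih =>
    simp only [branch]
    rw [hlt N (Nat.lt_succ_self N), ih fun k hk => hlt k (hk.trans (Nat.lt_succ_self N))]

/-- A family of functions that is continuous on a compact space `M` and determined by countably
many points of evaluation is separable for the supremum distance. -/
theorem exists_not_separated {ι T M : Type*} [Uncountable ι] [TopologicalSpace M] [CompactSpace M]
    [TopologicalSpace T] (e : T → M → ℝ) (he : ∀ t, Continuous (e t))
    (he' : ∀ m, Continuous fun t => e t m) {D : Set T} (hD : D.Countable)
    (x : ι → T) (hx : ∀ i, x i ∈ closure D) {ε : ℝ} (hε : 0 < ε) :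
    ∃ i j, i ≠ j ∧ ∀ m, |e (x i) m - e (x j) m| < ε := by
  have : Countable D := hD.to_subtype
  let q : M → (D → ℝ) := fun m d => e d m
  have hq : Continuous q := continuous_pi fun d => he d
  let K : Set (D → ℝ) := range q
  have hK : CompactSpace K := isCompact_iff_compactSpace.1 (isCompact_range hq)
  let q' : M → K := rangeFactorization q
  have hq' : Continuous q' := hq.subtype_mk _
  -- A continuous surjection from a compact space onto a Hausdorff one is a quotient map, so
  -- functions constant on its fibres descend to continuous functions on `K`.
  have hquot : IsQuotientMap q' :=
    hq'.isClosedMap.isQuotientMap hq' rangeFactorization_surjective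
  have hfac : ∀ i, ∃ F : C(K, ℝ), ∀ m, F (q' m) = e (x i) m := by
    intro i
    have hcongr : ∀ m m', q' m = q' m' → e (x i) m = e (x i) m' := by
      intro m m' hmm
      have hsub : closure D ⊆ {t | e t m = e t m'} := by
        refine closure_minimal (fun d hd => ?_) (isClosed_eq (he' m) (he' m'))
        exact congrFun (congrArg Subtype.val hmm) ⟨d, hd⟩
      exact hsub (hx i)
    refine ⟨⟨fun k => e (x i) (Function.surjInv rangeFactorization_surjective k), ?_⟩, fun m => ?_⟩
    · rw [hquot.continuous_iff]
      convert he (x i) using 1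
      funext m
      exact hcongr _ _ (Function.surjInv_eq rangeFactorization_surjective (q' m))
    · exact hcongr _ _ (Function.surjInv_eq rangeFactorization_surjective (q' m))
  choose F hF using hfac
  -- `K` is compact in a countable power of ℝ, hence metrizable, so C(K, ℝ) is separable. Two of the
  -- uncountably many `F i` must share an approximant.
  obtain ⟨S, hS, hSd⟩ := TopologicalSpace.exists_countable_dense C(K, ℝ)
  have hnear : ∀ i, ∃ s : S, dist (F i) s < ε / 2 := fun i => by
    obtain ⟨s, hs, hds⟩ := hSd.exists_dist_lt (F i) (half_pos hε)
    exact ⟨⟨s, hs⟩, hds⟩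
  choose s hs using hnear
  have : Countable S := hS.to_subtype
  have hninj : ¬ Function.Injective s := fun h => not_countable (α := ι) h.countable
  simp only [Function.Injective, not_forall] at hninj
  obtain ⟨i, j, hij, hne⟩ := hninj
  refine ⟨i, j, hne, fun m => ?_⟩
  rw [← hF, ← hF, ← Real.dist_eq]
  calc dist (F i (q' m)) (F j (q' m)) ≤ dist (F i) (F j) := ContinuousMap.dist_apply_le_dist _
    _ ≤ dist (F i) (s i) + dist (F j) (s i) := dist_triangle_right _ _ _
    _ < ε := by have := hs i; have := hs j; rw [← hij] at this; linarith

/-- A separately continuous function `e` on a product `T × M` of compact spaces defines a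
fragmented map from `T` to the functions on `M` with the supremum distance. -/
theorem exists_isOpen_small_oscillation {T M : Type*} [TopologicalSpace T] [CompactSpace T]
    [TopologicalSpace M] [CompactSpace M] (e : T → M → ℝ) (he : ∀ t, Continuous (e t))
    (he' : ∀ m, Continuous fun t => e t m) {A : Set T} (hA : A.Nonempty) {ε : ℝ} (hε : 0 < ε) :
    ∃ O : Set T, IsOpen O ∧ (O ∩ A).Nonempty ∧
      ∀ x ∈ O ∩ A, ∀ y ∈ O ∩ A, ∀ m, |e x m - e y m| ≤ ε := by
  by_contra! hcon
  let Node := {U : Set T // IsOpen U ∧ (U ∩ A).Nonempty}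
  -- Large oscillation on every node splits it into two open children on which evaluation at a
  -- single `m` differs by at least ε.
  have hstep : ∀ U : Node, ∃ (m : M) (c d : ℝ) (V : Bool → Node), ε ≤ c - d ∧
      (∀ b, (V b).1 ⊆ U.1) ∧ (∀ t ∈ (V true).1, c ≤ e t m) ∧ ∀ t ∈ (V false).1, e t m ≤ d := by
    rintro ⟨U, hU, hne⟩
    have key : ∃ x ∈ U ∩ A, ∃ y ∈ U ∩ A, ∃ m, ε < e x m - e y m := by
      obtain ⟨x, hx, y, hy, m, hm⟩ := hcon U hU hne
      rcases lt_abs.1 hm with h | h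
      · exact ⟨x, hx, y, hy, m, h⟩
      · exact ⟨y, hy, x, hx, m, by linarith⟩
    obtain ⟨x, hx, y, hy, m, hm⟩ := key
    -- Half of the excess over ε: moving both thresholds inwards by `r` leaves a gap of exactly ε
    -- and makes the children open.
    set r := (e x m - e y m - ε) / 2 with hr
    have hr0 : 0 < r := by rw [hr]; linarith
    refine ⟨m, e x m - r, e y m + r, fun b => if b then
      ⟨U ∩ {t | e x m - r < e t m}, hU.inter (isOpen_lt continuous_const (he' m)), x,
        ⟨hx.1, by simpa using hr0⟩, hx.2⟩ else
      ⟨U ∩ {t | e t m < e y m + r}, hU.inter (isOpen_lt (he' m) continuous_const), y,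
        ⟨hy.1, by simpa using hr0⟩, hy.2⟩, by rw [hr]; linarith, ?_, ?_, ?_⟩
    · rintro (_ | _) <;> simp [inter_subset_left]
    · simp only [if_true]
      exact fun t ht => le_of_lt ht.2
    · simp only [Bool.false_eq_true, if_false]
      exact fun t ht => le_of_lt ht.2
  choose m c d V hcd hVU hVt hVf using hstep
  let tree : List Bool → Node := fun l =>
    List.rec ⟨univ, isOpen_univ, by simpa using hA⟩ (fun b _ U => V U b) l
  have htree : ∀ b l, tree (b :: l) = V (tree l) b := fun _ _ => rfl
  let p : List Bool → T := fun l => (tree l).2.2.some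
  have hp : ∀ l, p l ∈ (tree l).1 := fun l => (tree l).2.2.some_mem.1
  have hanti : ∀ σ : ℕ → Bool, Antitone fun n => (tree (branch σ n)).1 := fun σ =>
    antitone_nat_of_succ_le fun n => by
      simp only [branch, htree]
      exact hVU _ _
  have hcl : ∀ σ : ℕ → Bool, ∃ x : T, MapClusterPt x atTop fun n => p (branch σ n) := fun σ =>
    exists_clusterPt_of_compactSpace _
  choose x hx using hcl
  have hxD : ∀ σ, x σ ∈ closure (range p) := fun σ =>
    isClosed_closure.mem_of_mapClusterPt (hx σ)
      (Eventually.of_forall fun n => subset_closure (mem_range_self _))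
  -- The nodes are only open, so a cluster point may leave them; it keeps just the closed
  -- conditions, which is why the bounds on `V` are recorded as non-strict inequalities.
  have hxV : ∀ σ n (C : Set T), IsClosed C → (V (tree (branch σ n)) (σ n)).1 ⊆ C → x σ ∈ C := by
    intro σ n C hC hsub
    refine hC.mem_of_mapClusterPt (hx σ) ?_
    filter_upwards [eventually_ge_atTop (n + 1)] with k hk
    exact hsub (hanti σ hk (hp _))
  have hxt : ∀ σ n, σ n = true → c (tree (branch σ n)) ≤ e (x σ) (m (tree (branch σ n))) :=
    fun σ n hσ => hxV σ n {t | c (tree (branch σ n)) ≤ e t (m (tree (branch σ n)))}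
      (isClosed_le continuous_const (he' _)) (by rw [hσ]; exact hVt _)
  have hxf : ∀ σ n, σ n = false → e (x σ) (m (tree (branch σ n))) ≤ d (tree (branch σ n)) :=
    fun σ n hσ => hxV σ n {t | e t (m (tree (branch σ n))) ≤ d (tree (branch σ n))}
      (isClosed_le (he' _) continuous_const) (by rw [hσ]; exact hVf _)
  have : Uncountable (ℕ → Bool) := by
    rw [← not_countable_iff]
    intro h
    obtain ⟨f, hf⟩ := exists_surjective_nat (ℕ → Bool)
    obtain ⟨n, hn⟩ := hf fun n => !f n n
    simpa using congrFun hn n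
  obtain ⟨σ, τ, hne, hlt⟩ := exists_not_separated e he he' (countable_range p) x hxD hε
  obtain ⟨n, hbr, hn⟩ := exists_branch_split hne
  have h0 := hlt (m (tree (branch σ n)))
  have h1 := hcd (tree (branch σ n))
  cases hσ : σ n with
  | true =>
    have hτ : τ n = false := by simpa [hσ] using hn.symm
    have h2 := hxt σ n hσ
    have h3 := hxf τ n hτ
    rw [← hbr] at h3
    have := (abs_lt.1 h0).2
    linarith
  | false =>
    have hτ : τ n = true := by simpa [hσ] using hn.symm
    have h2 := hxf σ n hσ
    have h3 := hxt τ n hτ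
    rw [← hbr] at h3
    have := (abs_lt.1 h0).1
    linarith

end Fragmentation

/-! ### Grothendieck's theorem: pointwise continuity implies weak continuity. -/

section Grothendieck

open MeasureTheory NNReal CompactlySupported Pointwise

variable {T : Type*} [TopologicalSpace T]

/-- A nonnegative continuous function on a compact space, as a real-valued function. -/
def nnrealToReal (f : C_c(T, ℝ≥0)) : C(T, ℝ) := ⟨fun t => f t, by fun_prop⟩

theorem nnrealToReal_nonneg (f : C_c(T, ℝ≥0)) (t : T) : 0 ≤ nnrealToReal f t := (f t).coe_nonneg

/-- The values of a functional on the functions dominated by `f`. -/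
def dominatedValues [CompactSpace T] (Φ : C(T, ℝ) →L[ℝ] ℝ) (f : C(T, ℝ)) : Set ℝ :=
  {r | ∃ g : C(T, ℝ), (∀ t, |g t| ≤ f t) ∧ Φ g = r}

section

variable [CompactSpace T] (Φ : C(T, ℝ) →L[ℝ] ℝ)

theorem bddAbove_dominatedValues (f : C(T, ℝ)) : BddAbove (dominatedValues Φ f) := by
  refine ⟨‖Φ‖ * ‖f‖, ?_⟩
  rintro _ ⟨g, hg, rfl⟩
  refine (le_abs_self _).trans ((Φ.le_opNorm g).trans ?_)
  gcongr
  rw [ContinuousMap.norm_le _ (norm_nonneg _)]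
  exact fun t => (hg t).trans ((le_abs_self _).trans (f.norm_coe_le_norm t))

theorem zero_mem_dominatedValues {f : C(T, ℝ)} (hf : ∀ t, 0 ≤ f t) :
    (0 : ℝ) ∈ dominatedValues Φ f := ⟨0, by simpa using hf, map_zero _⟩

/-- Riesz decomposition: truncating `g` to the band [-f₁, f₁] leaves a remainder bounded by `f₂`.
This is the additivity of the total variation. -/
theorem dominatedValues_add {f₁ f₂ : C(T, ℝ)} (h₁ : ∀ t, 0 ≤ f₁ t) (h₂ : ∀ t, 0 ≤ f₂ t) :
    dominatedValues Φ (f₁ + f₂) = dominatedValues Φ f₁ + dominatedValues Φ f₂ := by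
  ext r
  constructor
  · rintro ⟨g, hg, rfl⟩
    refine mem_add.2 ⟨_, ⟨(g ⊓ f₁) ⊔ (-f₁), fun t => ?_, rfl⟩, _,
      ⟨g - ((g ⊓ f₁) ⊔ (-f₁)), fun t => ?_, rfl⟩, by rw [← map_add]; congr 1; abel⟩
    · have := h₁ t
      simp only [ContinuousMap.sup_apply, ContinuousMap.inf_apply, ContinuousMap.neg_apply]
      rw [abs_le]
      exact ⟨le_sup_right, sup_le inf_le_right (by linarith)⟩
    · have h1 := h₁ t
      have h2 := h₂ t
      have h := abs_le.1 (hg t)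
      simp only [ContinuousMap.add_apply] at h
      simp only [ContinuousMap.sub_apply, ContinuousMap.sup_apply, ContinuousMap.inf_apply,
        ContinuousMap.neg_apply]
      rw [abs_le]
      rcases le_total (g t) (f₁ t) with h3 | h3
      · rw [inf_eq_left.2 h3]
        rcases le_total (g t) (-f₁ t) with h4 | h4
        · rw [sup_eq_right.2 h4]; constructor <;> linarith
        · rw [sup_eq_left.2 h4]; constructor <;> linarith
      · rw [inf_eq_right.2 h3, sup_eq_left.2 (by linarith)]
        constructor <;> linarith
  · intro hr
    obtain ⟨_, ⟨g₁, hg₁, rfl⟩, _, ⟨g₂, hg₂, rfl⟩, rfl⟩ := mem_add.1 hr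
    exact ⟨g₁ + g₂, fun t => (abs_add_le _ _).trans (add_le_add (hg₁ t) (hg₂ t)), map_add _ _ _⟩

theorem dominatedValues_smul {c : ℝ} (hc : 0 < c) (f : C(T, ℝ)) :
    dominatedValues Φ (c • f) = c • dominatedValues Φ f := by
  ext r
  constructor
  · rintro ⟨g, hg, rfl⟩
    refine mem_smul_set.2 ⟨_, ⟨c⁻¹ • g, fun t => ?_, rfl⟩, ?_⟩
    · have := hg t
      simp only [ContinuousMap.smul_apply, smul_eq_mul] at this ⊢
      rw [abs_mul, abs_of_pos (inv_pos.2 hc), inv_mul_le_iff₀ hc]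
      exact this
    · rw [map_smul, smul_inv_smul₀ hc.ne']
  · intro hr
    obtain ⟨_, ⟨g, hg, rfl⟩, rfl⟩ := mem_smul_set.1 hr
    refine ⟨c • g, fun t => ?_, map_smul _ _ _⟩
    simp only [ContinuousMap.smul_apply, smul_eq_mul]
    rw [abs_mul, abs_of_pos hc]
    exact mul_le_mul_of_nonneg_left (hg t) hc.le

theorem sSup_dominatedValues_nonneg {f : C(T, ℝ)} (hf : ∀ t, 0 ≤ f t) :
    0 ≤ sSup (dominatedValues Φ f) :=
  le_csSup (bddAbove_dominatedValues Φ f) (zero_mem_dominatedValues Φ hf)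

/-- The total variation of a functional on `C(T, ℝ)`, as a functional on the cone of nonnegative
functions. -/
noncomputable def variationFunctional : C_c(T, ℝ≥0) →ₗ[ℝ≥0] ℝ≥0 where
  toFun f := (sSup (dominatedValues Φ (nnrealToReal f))).toNNReal
  map_add' f₁ f₂ := by
    have h : nnrealToReal (f₁ + f₂) = nnrealToReal f₁ + nnrealToReal f₂ := rfl
    rw [h, dominatedValues_add Φ (nnrealToReal_nonneg f₁) (nnrealToReal_nonneg f₂),
      csSup_add ⟨0, zero_mem_dominatedValues Φ (nnrealToReal_nonneg f₁)⟩
        (bddAbove_dominatedValues _ _)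
        ⟨0, zero_mem_dominatedValues Φ (nnrealToReal_nonneg f₂)⟩ (bddAbove_dominatedValues _ _),
      Real.toNNReal_add (sSup_dominatedValues_nonneg Φ (nnrealToReal_nonneg f₁))
        (sSup_dominatedValues_nonneg Φ (nnrealToReal_nonneg f₂))]
  map_smul' c f := by
    have h : nnrealToReal (c • f) = (c : ℝ) • nnrealToReal f := rfl
    rw [h, RingHom.id_apply, smul_eq_mul, ← Real.toNNReal_coe (r := c),
      ← Real.toNNReal_mul c.coe_nonneg, Real.toNNReal_coe]
    congr 1
    -- The scaling lemma divides by `c`, so `c = 0` is treated apart.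
    rcases c.coe_nonneg.eq_or_lt with hc | hc
    · have hc' : (c : ℝ) = 0 := hc.symm
      rw [hc', zero_smul, zero_mul]
      have : dominatedValues Φ 0 = {0} := by
        ext r
        simp only [mem_singleton_iff]
        constructor
        · rintro ⟨g, hg, rfl⟩
          have : g = 0 := by
            ext t
            simpa using hg t
          rw [this, map_zero]
        · rintro rfl
          exact zero_mem_dominatedValues Φ fun t => le_rfl
      rw [this, csSup_singleton]
    · rw [dominatedValues_smul Φ (c := c) hc]
      exact Real.sSup_smul_of_nonneg c.coe_nonneg _

end

/-- Every continuous functional on `C(T, ℝ)` is dominated by the integral against a finite regular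
measure. -/
theorem exists_measure_abs_le_integral [CompactSpace T] [T2Space T] [MeasurableSpace T]
    [BorelSpace T] (Φ : C(T, ℝ) →L[ℝ] ℝ) :
    ∃ μ : Measure T, IsFiniteMeasure μ ∧ μ.Regular ∧ ∀ f : C(T, ℝ), |Φ f| ≤ ∫ t, |f t| ∂μ := by
  refine ⟨NNRealRMK.rieszMeasure (variationFunctional Φ), inferInstance, inferInstance,
    fun f => ?_⟩
  let F : C_c(T, ℝ≥0) :=
    CompactlySupportedContinuousMap.continuousMapEquiv ⟨fun t => ‖f t‖₊, by fun_prop⟩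
  have hF : ∀ t, ((F t : ℝ≥0) : ℝ) = |f t| := fun t => rfl
  have h := NNRealRMK.integral_rieszMeasure (variationFunctional Φ) F
  simp only [hF] at h
  rw [h]
  rw [variationFunctional, LinearMap.coe_mk, AddHom.coe_mk,
    Real.coe_toNNReal _ (sSup_dominatedValues_nonneg Φ (nnrealToReal_nonneg F))]
  rcases abs_cases (Φ f) with ⟨h1, -⟩ | ⟨h1, -⟩
  · rw [h1]
    exact le_csSup (bddAbove_dominatedValues Φ _) ⟨f, fun t => le_rfl, rfl⟩
  · rw [h1]
    exact le_csSup (bddAbove_dominatedValues Φ _)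
      ⟨-f, fun t => by rw [ContinuousMap.neg_apply, abs_neg]; exact le_rfl, map_neg _ _⟩

/-- **Grothendieck**: on a bounded family of continuous functions on a compact space that is
parametrized by a compact space, continuity for the topology of pointwise convergence implies weak
continuity. -/
theorem continuous_of_forall_eval [CompactSpace T] [T2Space T] {M : Type*} [TopologicalSpace M]
    [CompactSpace M] (c : M → C(T, ℝ)) (hc : ∀ t, Continuous fun m => c m t) {C : ℝ}
    (hC : ∀ m, ‖c m‖ ≤ C) (Φ : C(T, ℝ) →L[ℝ] ℝ) : Continuous fun m => Φ (c m) := by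
  let _ : MeasurableSpace T := borel T
  have : BorelSpace T := ⟨rfl⟩
  obtain ⟨μ, _, _, hμ⟩ := exists_measure_abs_le_integral Φ
  rw [continuous_iff_continuousAt]
  intro m₀
  let D : M → T → ℝ := fun m t => |c m t - c m₀ t|
  have hDc : ∀ m, Continuous (D m) := fun m => by fun_prop
  have hD2 : ∀ m t, D m t ≤ 2 * C := fun m t => by
    have h1 := (abs_sub (c m t) (c m₀ t))
    have h2 : |c m t| ≤ C := ((c m).norm_coe_le_norm t).trans (hC m)
    have h3 : |c m₀ t| ≤ C := ((c m₀).norm_coe_le_norm t).trans (hC m₀)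
    simp only [D]
    linarith
  -- Convergence in measure. Dominated convergence is not available because `𝓝 m₀` need not be
  -- countably generated; fragmentation replaces it. A set is good when the claim holds on it, and
  -- the largest open good set is shown to be everything.
  have key : ∀ ε > 0, ∀ δ > (0 : ENNReal), ∀ᶠ m in 𝓝 m₀, μ {t | ε < D m t} ≤ δ := by
    intro ε hε
    let good : Set T → Prop := fun W =>
      ∀ δ > (0 : ENNReal), ∀ᶠ m in 𝓝 m₀, μ (W ∩ {t | ε < D m t}) ≤ δ
    have good_union : ∀ W W' : Set T, good W → good W' → good (W ∪ W') := by
      intro W W' h h' δ hδ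
      filter_upwards [h (δ / 2) (ENNReal.half_pos hδ.ne'), h' (δ / 2) (ENNReal.half_pos hδ.ne')]
        with m h1 h2
      rw [union_inter_distrib_right]
      exact (measure_union_le _ _).trans ((add_le_add h1 h2).trans (ENNReal.add_halves δ).le)
    let U : Set T := ⋃₀ {W | IsOpen W ∧ good W}
    have hU : IsOpen U := isOpen_sUnion fun W hW => hW.1
    have hUgood : good U := by
      intro δ hδ
      -- Inner regularity reduces an arbitrary union of good open sets to a finite one, up to
      -- measure δ/2.
      obtain ⟨K, hKU, hK, hμK⟩ := hU.measurableSet.exists_isCompact_sdiff_lt (measure_ne_top μ U)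
        (ENNReal.half_pos hδ.ne').ne'
      have hgK : good K := by
        refine hK.induction_on ?_ ?_ ?_ ?_
        · intro δ hδ
          simp
        · intro s t hst ht δ hδ
          filter_upwards [ht δ hδ] with m hm
          exact (measure_mono (inter_subset_inter_left _ hst)).trans hm
        · exact good_union
        · intro x hx
          obtain ⟨W, hW, hxW⟩ := hKU hx
          exact ⟨W, mem_nhdsWithin_of_mem_nhds (hW.1.mem_nhds hxW), hW.2⟩
      filter_upwards [hgK (δ / 2) (ENNReal.half_pos hδ.ne')] with m hm
      have hsub : U ∩ {t | ε < D m t} ⊆ (K ∩ {t | ε < D m t}) ∪ (U \ K) := by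
        rintro t ⟨ht, ht'⟩
        by_cases htK : t ∈ K
        · exact Or.inl ⟨htK, ht'⟩
        · exact Or.inr ⟨ht, htK⟩
      exact (measure_mono hsub).trans ((measure_union_le _ _).trans
        ((add_le_add hm hμK.le).trans (ENNReal.add_halves δ).le))
    -- On a piece of the complement of `U` with oscillation at most ε/3, smallness of `D m` at one
    -- point `t₀` spreads to the whole piece: ε/3 for the value at `m`, ε/3 for the value at `m₀`,
    -- ε/3 at `t₀`. Then `U` could be enlarged.
    have hUuniv : U = univ := by
      by_contra hne
      obtain ⟨O, hO, ⟨t₀, ht₀⟩, hsmall⟩ := exists_isOpen_small_oscillation (fun t m => c m t) hc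
        (fun m => (c m).continuous) (nonempty_compl.2 hne) (ε := ε / 3) (by positivity)
      have hOgood : good (U ∪ (O ∩ Uᶜ)) := by
        refine good_union _ _ hUgood fun δ hδ => ?_
        have hnear : ∀ᶠ m in 𝓝 m₀, D m t₀ < ε / 3 := by
          have : ContinuousAt (fun m => D m t₀) m₀ := by
            have := hc t₀
            exact Continuous.continuousAt (by fun_prop)
          refine this.eventually_lt_const ?_
          simp only [D, sub_self, abs_zero]
          positivity
        filter_upwards [hnear] with m hm
        have hempty : (O ∩ Uᶜ) ∩ {t | ε < D m t} = ∅ := by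
          rw [eq_empty_iff_forall_notMem]
          rintro t ⟨ht, ht'⟩
          have h1 := abs_le.1 (hsmall t ht t₀ ht₀ m)
          have h2 := abs_le.1 (hsmall t ht t₀ ht₀ m₀)
          have h3 := abs_lt.1 hm
          have h4 : D m t ≤ ε := by refine abs_le.2 ⟨?_, ?_⟩ <;> linarith
          exact absurd ht' (not_lt.2 h4)
        rw [hempty, measure_empty]
        exact zero_le
      have hOU : U ∪ (O ∩ Uᶜ) = U ∪ O := by
        rw [union_inter_distrib_left, union_compl_self, inter_univ]
      rw [hOU] at hOgood
      exact ht₀.2 (mem_sUnion.2 ⟨U ∪ O, ⟨hU.union hO, hOgood⟩, Or.inr ht₀.1⟩)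
    intro δ hδ
    simpa [hUuniv] using hUgood δ hδ
  rw [ContinuousAt, Metric.tendsto_nhds]
  intro η hη
  have hC0 : 0 ≤ C := (norm_nonneg _).trans (hC m₀)
  -- The final bound is ε·μ(T) + 2C·δ, and each term is to stay below η/2; the summands 1 guard
  -- against μ(T) = 0 and C = 0.
  set ε := η / (2 * (μ.real univ + 1)) with hε
  set δ := η / (4 * (C + 1)) with hδ
  have hμ0 : 0 ≤ μ.real univ := measureReal_nonneg
  have hεpos : 0 < ε := by positivity
  have hδpos : 0 < δ := by positivity
  filter_upwards [key ε hεpos (ENNReal.ofReal δ) (ENNReal.ofReal_pos.2 hδpos)] with m hm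
  have hmeas : MeasurableSet {t | ε < D m t} := (isOpen_lt continuous_const (hDc m)).measurableSet
  have hm' : μ.real {t | ε < D m t} ≤ δ := ENNReal.toReal_le_of_le_ofReal hδpos.le hm
  rw [Real.dist_eq, ← map_sub]
  have hint : ∫ t, D m t ∂μ ≤ ∫ t, (ε + {t | ε < D m t}.indicator (fun _ => 2 * C) t) ∂μ := by
    refine integral_mono (f := D m) ?_ ?_ fun t => ?_
    · exact Integrable.of_bound (hDc m).aestronglyMeasurable (2 * C)
        (Eventually.of_forall fun t => by
          rw [Real.norm_eq_abs, abs_of_nonneg (abs_nonneg _)]; exact hD2 m t)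
    · exact (integrable_const _).add ((integrable_const _).indicator hmeas)
    · by_cases ht : ε < D m t
      · rw [indicator_of_mem (show t ∈ {t | ε < D m t} from ht)]
        have := hD2 m t
        linarith
      · rw [indicator_of_notMem (show t ∉ {t | ε < D m t} from ht), add_zero]
        exact not_lt.1 ht
  calc |Φ (c m - c m₀)| ≤ ∫ t, D m t ∂μ := hμ _
    _ ≤ _ := hint
    _ = μ.real univ * ε + μ.real {t | ε < D m t} * (2 * C) := by
      rw [integral_add (integrable_const _) ((integrable_const _).indicator hmeas),
        integral_const, integral_indicator_const _ hmeas, smul_eq_mul, smul_eq_mul]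
    _ ≤ μ.real univ * ε + δ * (2 * C) := by gcongr
    _ < η := by
      have h1 : (μ.real univ + 1) * ε = η / 2 := by rw [hε]; field_simp
      have h2 : δ * (2 * (C + 1)) = η / 2 := by rw [hδ]; field_simp; ring
      nlinarith

end Grothendieck

/-! ### Gelfand spaces as compactifications, and their factor maps. -/

section Gelfand

theorem compactSpace_characterSpace (B : Type*) [NormedRing B] [NormedAlgebra ℝ B]
    [CompleteSpace B] : CompactSpace (WeakDual.characterSpace ℝ B) := inferInstance

/-- The factor ‖1‖ is kept because ‖1‖ = 1 fails for functions on an empty space. -/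
theorem abs_character_apply_le (B : Type*) [NormedRing B] [NormedAlgebra ℝ B] [CompleteSpace B]
    (φ : WeakDual.characterSpace ℝ B) (b : B) : |φ b| ≤ ‖(1 : B)‖ * ‖b‖ :=
  ((WeakDual.toStrongDual (φ : WeakDual ℝ B)).le_opNorm b).trans
    (mul_le_mul_of_nonneg_right (WeakDual.CharacterSpace.norm_le_norm_one φ) (norm_nonneg b))

variable {G : Type v} [Group G] {X : Type u} [TopologicalSpace X] [MulAction G X]
  [ContinuousConstSMul G X]

namespace GSubalgebra

variable (A : GSubalgebra G X)

instance completeSpace_toSubalgebra : CompleteSpace A.toSubalgebra :=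
  A.isClosed'.completeSpace_coe

instance compactSpace_gelfand : CompactSpace A.Gelfand :=
  compactSpace_characterSpace A.toSubalgebra

theorem abs_apply_le_norm (φ : A.Gelfand) (f : A.toSubalgebra) : |φ f| ≤ ‖f‖ := by
  have h1 : ‖(1 : A.toSubalgebra)‖ ≤ 1 :=
    (BoundedContinuousFunction.norm_le zero_le_one).2 fun x => by simp
  exact (abs_character_apply_le A.toSubalgebra φ f).trans
    (mul_le_of_le_one_left (norm_nonneg f) h1)

theorem apply_sub (φ : A.Gelfand) (f h : A.toSubalgebra) : φ (f - h) = φ f - φ h :=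
  map_sub φ f h

theorem isInducing_gelfand :
    IsInducing fun (φ : A.Gelfand) (f : A.toSubalgebra) => φ f := by
  have h : IsInducing fun (φ : WeakDual ℝ A.toSubalgebra) (f : A.toSubalgebra) => φ f := ⟨rfl⟩
  exact h.comp IsInducing.subtypeVal

theorem continuous_gelfand_iff {Z : Type*} [TopologicalSpace Z] {F : Z → A.Gelfand} :
    Continuous F ↔ ∀ f, Continuous fun z => F z f := by
  rw [A.isInducing_gelfand.continuous_iff, continuous_pi_iff]
  rfl

theorem continuous_eval (f : A.toSubalgebra) : Continuous fun φ : A.Gelfand => φ f :=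
  A.continuous_gelfand_iff.1 continuous_id f

theorem t2Space_gelfand : T2Space A.Gelfand := by
  refine T2Space.of_injective_continuous (f := fun (φ : A.Gelfand) (f : A.toSubalgebra) => φ f)
    (fun φ ψ h => WeakDual.CharacterSpace.ext fun f => congrFun h f) A.isInducing_gelfand.continuous

theorem continuous_eva : Continuous A.eva :=
  A.continuous_gelfand_iff.2 fun f => f.1.continuous

theorem eva_smul (g : G) (x : X) : A.eva (g • x) = g • A.eva x :=
  WeakDual.CharacterSpace.ext fun _ => rfl

/-- If a basic neighbourhood of φ missed the image of X, the sum `h` of the squares ((f - φ(f))/δ)²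
would be at least 1 on X while φ(h) = 0. Then ‖h‖ + 1 - h has norm at most ‖h‖ but φ-value ‖h‖ + 1,
although characters do not increase norms. -/
theorem denseRange_eva : DenseRange A.eva := by
  intro φ
  rw [A.isInducing_gelfand.closure_eq_preimage_closure_image, mem_preimage,
    mem_closure_iff_nhds]
  intro S hS
  rw [nhds_pi, Filter.mem_pi] at hS
  obtain ⟨I, hI, t, ht, htS⟩ := hS
  have hball : ∀ f, ∃ δ > 0, Metric.ball (φ f) δ ⊆ t f := fun f => Metric.mem_nhds_iff.1 (ht f)
  choose δ hδ hδt using hball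
  lift I to Finset A.toSubalgebra using hI
  let w : A.toSubalgebra → A.toSubalgebra := fun f =>
    (δ f)⁻¹ • (f - algebraMap ℝ A.toSubalgebra (φ f))
  let h : A.toSubalgebra := ∑ f ∈ I, w f * w f
  have hφw : ∀ f, φ (w f) = 0 := fun f => by
    simp only [w]
    rw [map_smul, A.apply_sub, AlgHomClass.commutes]
    simp
  have hφh : φ h = 0 := by
    simp only [h, map_sum, map_mul, hφw, mul_zero, Finset.sum_const_zero]
  have hw : ∀ f x, (w f).1 x = (δ f)⁻¹ * (f.1 x - φ f) := fun f x => by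
    simp [w, Algebra.algebraMap_eq_smul_one]
  have hx : ∀ x, h.1 x = ∑ f ∈ I, (w f).1 x * (w f).1 x := fun x => by
    simp only [h, AddSubmonoidClass.coe_finsetSum]
    simp
  have hex : ∃ x, h.1 x < 1 := by
    by_contra! hcon
    have hle := A.abs_apply_le_norm φ (algebraMap ℝ A.toSubalgebra (‖h‖ + 1) - h)
    rw [A.apply_sub, hφh, AlgHomClass.commutes, sub_zero] at hle
    have hnorm : ‖algebraMap ℝ A.toSubalgebra (‖h‖ + 1) - h‖ ≤ ‖h‖ := by
      refine (BoundedContinuousFunction.norm_le (norm_nonneg h)).2 fun x => ?_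
      have h1 : (algebraMap ℝ A.toSubalgebra (‖h‖ + 1) - h).1 x = ‖h‖ + 1 - h.1 x := by
        simp [Algebra.algebraMap_eq_smul_one]
      have h2 := (le_abs_self _).trans (h.1.norm_coe_le_norm x)
      change h.1 x ≤ ‖h‖ at h2
      have h3 := hcon x
      change |(algebraMap ℝ A.toSubalgebra (‖h‖ + 1) - h).1 x| ≤ _
      rw [h1, abs_le]
      constructor <;> linarith
    have h4 : ‖h‖ + 1 ≤ ‖h‖ := (le_abs_self _).trans (hle.trans hnorm)
    linarith
  obtain ⟨x, hx1⟩ := hex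
  refine ⟨_, htS fun f hf => hδt f ?_, A.eva x, ⟨x, rfl⟩, rfl⟩
  change dist (f.1 x) (φ f) < δ f
  rw [Real.dist_eq]
  have h1 : (w f).1 x * (w f).1 x < 1 := by
    refine lt_of_le_of_lt ?_ ((hx x).symm.trans_lt hx1)
    exact Finset.single_le_sum (f := fun f => (w f).1 x * (w f).1 x)
      (fun f _ => mul_self_nonneg _) hf
  have h2 : |(w f).1 x| < 1 := by
    rw [← sq, sq_lt_one_iff_abs_lt_one] at h1
    exact h1
  rw [hw, abs_mul, abs_inv, abs_of_pos (hδ f), inv_mul_lt_iff₀ (hδ f), mul_one] at h2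
  exact h2

/-- If `B ⊆ A`, restriction of functionals is a map `|A| → |B|`. -/
noncomputable def restrict {A B : GSubalgebra G X} (h : B.functions ⊆ A.functions)
    (φ : A.Gelfand) : B.Gelfand :=
  ⟨StrongDual.toWeakDual ((WeakDual.toStrongDual φ.1).comp
    (⟨(Subalgebra.inclusion h).toLinearMap, continuous_inclusion h⟩ :
      B.toSubalgebra →L[ℝ] A.toSubalgebra)), by
    constructor
    · intro h0
      have h1 : φ (1 : A.toSubalgebra) = 0 := congrArg (fun ψ : WeakDual ℝ B.toSubalgebra => ψ 1) h0
      rw [map_one] at h1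
      exact one_ne_zero h1
    · intro a b
      exact map_mul φ (Subalgebra.inclusion h a) (Subalgebra.inclusion h b)⟩

/-- Restriction of characters has compact image containing the dense image of X, hence is onto;
density of X in |A| gives uniqueness. -/
theorem hasGFactorMap {A B : GSubalgebra G X} (h : B.functions ⊆ A.functions) :
    HasGFactorMap A B := by
  have := A.t2Space_gelfand
  have := B.t2Space_gelfand
  have hcont : Continuous (restrict h) :=
    B.continuous_gelfand_iff.2 fun f => A.continuous_eval ⟨f.1, h f.2⟩
  have heva : ∀ x, restrict h (A.eva x) = B.eva x := fun x =>
    WeakDual.CharacterSpace.ext fun f => rfl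
  refine ⟨restrict h, ⟨hcont, ?_, ?_, heva⟩, ?_⟩
  · have hsub : range B.eva ⊆ range (restrict h) := by
      rintro _ ⟨x, rfl⟩
      exact ⟨A.eva x, heva x⟩
    have hd : Dense (range (restrict h)) := B.denseRange_eva.mono hsub
    rw [← range_eq_univ, ← (isCompact_range hcont).isClosed.closure_eq]
    exact hd.closure_eq
  · exact fun g φ => WeakDual.CharacterSpace.ext fun f => rfl
  · rintro β ⟨hβ, -, -, hβe⟩
    exact A.denseRange_eva.equalizer hβ hcont
      (funext fun x => (hβe x).trans (heva x).symm)

/-- Since characters are uniformly bounded, norm continuity in one variable and weak-star continuity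
in the other combine to joint continuity. With `a` the orbit map of an RUC function, this yields a
jointly continuous action on |A|. -/
theorem continuous_apply_of_continuous {Z : Type*} [TopologicalSpace Z] {a : Z → A.toSubalgebra}
    (ha : Continuous a) : Continuous fun p : Z × A.Gelfand => p.2 (a p.1) := by
  rw [continuous_iff_continuousAt]
  rintro ⟨z, φ⟩
  have h1 : Tendsto (fun p : Z × A.Gelfand => p.2 (a p.1 - a z)) (𝓝 (z, φ)) (𝓝 0) := by
    refine squeeze_zero_norm (fun p => A.abs_apply_le_norm p.2 _) ?_
    have : Continuous fun p : Z × A.Gelfand => ‖(a p.1).1 - (a z).1‖ :=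
      continuous_norm.comp
        ((continuous_subtype_val.comp (ha.comp continuous_fst)).sub continuous_const)
    have h0 := this.tendsto (z, φ)
    rwa [sub_self, norm_zero] at h0
  have h2 : Tendsto (fun p : Z × A.Gelfand => p.2 (a z)) (𝓝 (z, φ)) (𝓝 (φ (a z))) :=
    ((A.continuous_eval (a z)).comp continuous_snd).tendsto (z, φ)
  have h3 := h1.add h2
  rw [zero_add] at h3
  refine h3.congr fun p => ?_
  rw [A.apply_sub, sub_add_cancel]

theorem isGCompactification_eva [TopologicalSpace G] (h : A.functions ⊆ RUC G X) :
    IsGCompactification G A.eva where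
  compact := inferInstance
  t2 := A.t2Space_gelfand
  continuousSMul := by
    refine ⟨A.continuous_gelfand_iff.2 fun f => ?_⟩
    exact A.continuous_apply_of_continuous (a := fun g => A.translateL g f)
      ((h f.2).subtype_mk _)
  continuous := A.continuous_eva
  denseRange := A.denseRange_eva
  map_smul := A.eva_smul

end GSubalgebra

end Gelfand

/-! ### Pulling functions back along dense maps into compact spaces. -/

section Pullback

variable {X Y : Type*} [TopologicalSpace X] [TopologicalSpace Y] [CompactSpace Y]

/-- Composition with a continuous map into a compact space. -/
noncomputable def pullback (ν : C(X, Y)) (F : C(Y, ℝ)) : X →ᵇ ℝ :=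
  (BoundedContinuousFunction.mkOfCompact F).compContinuous ν

theorem isometry_pullback {ν : C(X, Y)} (hν : DenseRange ν) : Isometry (pullback ν) := by
  refine Isometry.of_dist_eq fun F H => le_antisymm ?_ ?_
  · exact (BoundedContinuousFunction.dist_le dist_nonneg).2 fun x =>
      ContinuousMap.dist_apply_le_dist (ν x)
  · refine (ContinuousMap.dist_le dist_nonneg).2 fun y => ?_
    have hsub : closure (range ν) ⊆ {y | dist (F y) (H y) ≤ dist (pullback ν F) (pullback ν H)} := by
      refine closure_minimal ?_ (isClosed_le (by fun_prop) continuous_const)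
      rintro _ ⟨x, rfl⟩
      exact BoundedContinuousFunction.dist_coe_le_dist (f := pullback ν F) (g := pullback ν H) x
    exact hsub (hν y)

end Pullback

/-! ### SUC, LE and HNS systems: implications and permanence. -/

section Classes

variable {G : Type v} [Group G]

/-- Every nonempty subset of `Y` has nonempty relatively open subsets whose translates are all
uniformly small. -/
def IsFragmented (G : Type v) [Group G] (Y : Type*) [UniformSpace Y] [MulAction G Y] : Prop :=
  ∀ ε ∈ 𝓤 Y, ∀ A : Set Y, A.Nonempty → ∃ O : Set Y, IsOpen O ∧ (O ∩ A).Nonempty ∧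
    ∀ g : G, ∀ x ∈ O ∩ A, ∀ y ∈ O ∩ A, (g • x, g • y) ∈ ε

theorem IsFragmented.isHNS {Y : Type u} [UniformSpace Y] [MulAction G Y]
    (h : IsFragmented G Y) : IsHNS G Y := by
  rintro Z - hZ - ⟨ε, hε, hs⟩
  obtain ⟨O, hO, hne, hsmall⟩ := h ε hε Z hZ
  obtain ⟨g, x, hx, y, hy, hxy⟩ := hs O hO hne
  exact hxy (hsmall g x hx y hy)

/-- Fix ε and exhaust: let `U` be the largest open invariant set such that every subset meeting it
has an ε-small piece. If the closed invariant complement were nonempty, non-sensitivity would give a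
small `O` in it, and adding all translates of `O` would enlarge `U`. -/
theorem IsHNS.isFragmented {Y : Type u} [UniformSpace Y] [MulAction G Y]
    [ContinuousConstSMul G Y] (h : IsHNS G Y) : IsFragmented G Y := by
  intro ε hε
  let good : Set Y → Prop := fun W => IsOpen W ∧ (∀ g : G, ∀ x ∈ W, g • x ∈ W) ∧
    ∀ A : Set Y, (A ∩ W).Nonempty → ∃ O : Set Y, IsOpen O ∧ (O ∩ A).Nonempty ∧
      ∀ g : G, ∀ x ∈ O ∩ A, ∀ y ∈ O ∩ A, (g • x, g • y) ∈ ε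
  let U : Set Y := ⋃₀ {W | good W}
  have hU : good U := by
    refine ⟨isOpen_sUnion fun W hW => hW.1, ?_, ?_⟩
    · rintro g x ⟨W, hW, hx⟩
      exact ⟨W, hW, hW.2.1 g x hx⟩
    · rintro A ⟨a, haA, W, hW, haW⟩
      exact hW.2.2 A ⟨a, haA, haW⟩
  by_cases huniv : U = univ
  · intro A hA
    exact hU.2.2 A (by rwa [huniv, inter_univ])
  exfalso
  have hinv : ∀ g : G, ∀ z ∈ Uᶜ, g • z ∈ Uᶜ := fun g z hz hgz =>
    hz (by simpa using hU.2.1 g⁻¹ _ hgz)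
  have hns := h Uᶜ hU.1.isClosed_compl (nonempty_compl.2 huniv) hinv
  simp only [IsSensitiveOn, not_exists, not_and, not_forall, exists_prop, not_not] at hns
  obtain ⟨O, hO, ⟨z, hzO, hzU⟩, hsmall⟩ := hns ε hε
  have hgood : good (U ∪ ⋃ k : G, (k • ·) ⁻¹' O) := by
    refine ⟨hU.1.union (isOpen_iUnion fun k => hO.preimage (continuous_const_smul k)), ?_, ?_⟩
    · rintro g x (hx | hx)
      · exact Or.inl (hU.2.1 g x hx)
      · obtain ⟨k, hk⟩ := mem_iUnion.1 hx
        refine Or.inr (mem_iUnion.2 ⟨k * g⁻¹, ?_⟩)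
        simpa [mul_smul] using hk
    · rintro A ⟨a, haA, ha⟩
      by_cases hAU : (A ∩ U).Nonempty
      · exact hU.2.2 A hAU
      have hA : ∀ x ∈ A, x ∈ Uᶜ := fun x hx hxU => hAU ⟨x, hx, hxU⟩
      obtain ⟨k, hk⟩ := mem_iUnion.1 (ha.resolve_left (hA a haA))
      refine ⟨(k • ·) ⁻¹' O, hO.preimage (continuous_const_smul k), ⟨a, hk, haA⟩, ?_⟩
      rintro g x ⟨hx, hxA⟩ y ⟨hy, hyA⟩
      -- Smallness under all of G is unaffected by moving `O` with `k`: g x = (g k⁻¹)(k x).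
      have := hsmall (g * k⁻¹) (k • x) ⟨hx, hinv k x (hA x hxA)⟩ (k • y) ⟨hy, hinv k y (hA y hyA)⟩
      simpa [mul_smul] using this
  exact hzU ⟨_, hgood, Or.inr (mem_iUnion.2 ⟨1, by simpa using hzO⟩)⟩

theorem smul_mem_closure_orbit {Y : Type*} [TopologicalSpace Y] [MulAction G Y]
    [ContinuousConstSMul G Y] (x₀ : Y) (g : G) {y : Y} (hy : y ∈ closure (MulAction.orbit G x₀)) :
    g • y ∈ closure (MulAction.orbit G x₀) :=
  map_mem_closure (continuous_const_smul g) hy (by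
    rintro _ ⟨k, rfl⟩
    exact ⟨g * k, mul_smul g k x₀⟩)

/-- A small relatively open piece of the orbit closure contains some k x₀ by density; its preimage
under `k` is a neighbourhood of x₀ whose translates are equally small. -/
theorem IsFragmented.isLE {Y : Type u} [UniformSpace Y] [MulAction G Y]
    [ContinuousConstSMul G Y] (h : IsFragmented G Y) : IsLE G Y := by
  intro x₀ ε hε
  have hx₀ : x₀ ∈ closure (MulAction.orbit G x₀) := subset_closure (MulAction.mem_orbit_self x₀)
  obtain ⟨O, hO, ⟨y, hyO, hy⟩, hsmall⟩ := h ε hε _ ⟨x₀, hx₀⟩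
  obtain ⟨_, hkO, k, rfl⟩ := mem_closure_iff.1 hy O hO hyO
  have hnhds : (k • ·) ⁻¹' O ∈ 𝓝 x₀ := (hO.preimage (continuous_const_smul k)).mem_nhds hkO
  filter_upwards [mem_nhdsWithin_of_mem_nhds hnhds, self_mem_nhdsWithin] with x hx hxcl g
  have := hsmall (g * k⁻¹) (k • x₀) ⟨hkO, smul_mem_closure_orbit x₀ k hx₀⟩ (k • x)
    ⟨hx, smul_mem_closure_orbit x₀ k hxcl⟩
  simpa [mul_smul] using this

/-- As u → e, the points u x₀ approach x₀ without leaving the orbit closure, where equicontinuity at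
x₀ applies. -/
theorem IsLE.isSUC [TopologicalSpace G] {Y : Type u} [UniformSpace Y] [MulAction G Y]
    [ContinuousSMul G Y] (h : IsLE G Y) : IsSUC G Y := by
  intro x₀ ε hε
  have hT : Tendsto (fun u : G => u • x₀) (𝓝 1) (𝓝[closure (MulAction.orbit G x₀)] x₀) := by
    refine tendsto_nhdsWithin_iff.2 ⟨?_, Eventually.of_forall fun u =>
      subset_closure (MulAction.mem_orbit x₀ u)⟩
    have : Continuous fun u : G => u • x₀ := by fun_prop
    simpa using this.tendsto 1
  have hev := hT.eventually (h x₀ (Prod.swap ⁻¹' ε) (symm_le_uniformity hε))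
  refine ⟨_, hev, fun g u hu => ?_⟩
  rw [mul_smul]
  exact hu g

/-- The class `P` of `G`-systems is stable under initial families of `G`-maps, that is, under
subsystems of products. -/
def StableUnderInitial (G : Type v) [Group G]
    (P : ∀ (Y : Type u) [UniformSpace Y] [MulAction G Y], Prop) : Prop :=
  ∀ (ι : Type) (Z : Type u) [UniformSpace Z] [MulAction G Z] [ContinuousConstSMul G Z]
    (Y : ι → Type u) [∀ i, UniformSpace (Y i)] [∀ i, MulAction G (Y i)]
    [∀ i, ContinuousConstSMul G (Y i)] (π : ∀ i, Z → Y i),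
    (∀ i (g : G) z, π i (g • z) = g • π i z) →
    𝓤 Z = ⨅ i, comap (Prod.map (π i) (π i)) (𝓤 (Y i)) → (∀ i, P (Y i)) → P Z

/-- As a limit into the uniformity, the condition can be tested on each member of an infimum of
uniformities. -/
theorem isSUC_iff_tendsto [TopologicalSpace G] {Y : Type u} [UniformSpace Y] [MulAction G Y] :
    IsSUC G Y ↔ ∀ x₀ : Y, Tendsto (fun p : G × G => ((p.2 * p.1) • x₀, p.2 • x₀))
      (𝓝 1 ×ˢ ⊤) (𝓤 Y) := by
  refine forall_congr' fun x₀ => forall₂_congr fun ε hε => ?_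
  rw [mem_map, mem_prod_top]
  constructor
  · rintro ⟨U, hU, h⟩
    exact mem_of_superset hU fun u hu g => h g u hu
  · exact fun h => ⟨_, h, fun g u hu => hu g⟩

theorem stableUnderInitial_isSUC [TopologicalSpace G] :
    StableUnderInitial.{u} G (fun Y _ _ => IsSUC G Y) := by
  intro ι Z _ _ _ Y _ _ _ π hπ hZ hY
  rw [isSUC_iff_tendsto]
  intro x₀
  rw [hZ, tendsto_iInf]
  intro i
  rw [tendsto_comap_iff]
  refine (isSUC_iff_tendsto.1 (hY i) (π i x₀)).congr fun p => ?_
  simp only [Function.comp_apply, Prod.map_apply, hπ]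

theorem equicontinuousWithinAt_iff_tendsto {Y : Type*} [UniformSpace Y] [MulAction G Y]
    {S : Set Y} {x₀ : Y} : EquicontinuousWithinAt (fun (g : G) (y : Y) => g • y) S x₀ ↔
      Tendsto (fun p : Y × G => (p.2 • x₀, p.2 • p.1)) (𝓝[S] x₀ ×ˢ ⊤) (𝓤 Y) := by
  refine forall₂_congr fun ε hε => ?_
  rw [mem_map, mem_prod_top]
  rfl

theorem continuous_of_uniformity_eq_iInf {ι : Type*} {Z : Type*} [UniformSpace Z] {Y : ι → Type*}
    [∀ i, UniformSpace (Y i)] {π : ∀ i, Z → Y i}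
    (hZ : 𝓤 Z = ⨅ i, comap (Prod.map (π i) (π i)) (𝓤 (Y i))) (i : ι) : Continuous (π i) := by
  refine UniformContinuous.continuous ?_
  rw [UniformContinuous, hZ]
  exact tendsto_comap.mono_left (iInf_le _ i)

theorem stableUnderInitial_isLE : StableUnderInitial.{u} G (fun Y _ _ => IsLE G Y) := by
  intro ι Z _ _ _ Y _ _ _ π hπ hZ hY x₀
  rw [equicontinuousWithinAt_iff_tendsto, hZ, tendsto_iInf]
  intro i
  rw [tendsto_comap_iff]
  have hcont := continuous_of_uniformity_eq_iInf hZ i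
  have hmap : MapsTo (π i) (closure (MulAction.orbit G x₀))
      (closure (MulAction.orbit G (π i x₀))) := by
    refine MapsTo.closure ?_ hcont
    rintro _ ⟨g, rfl⟩
    exact ⟨g, (hπ i g x₀).symm⟩
  have hT := hcont.continuousWithinAt.tendsto_nhdsWithin hmap (x := x₀)
  refine ((equicontinuousWithinAt_iff_tendsto.1 (hY i (π i x₀))).comp
    (hT.prodMap tendsto_id)).congr fun p => ?_
  simp only [Function.comp_apply, Prod.map_apply, hπ]
  rfl

/-- The entourages for which the condition of fragmentedness holds form a filter. -/
def fragmentationFilter (G : Type v) [Group G] (Y : Type*) [TopologicalSpace Y] [MulAction G Y] :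
    Filter (Y × Y) where
  sets := {ε | ∀ A : Set Y, A.Nonempty → ∃ O : Set Y, IsOpen O ∧ (O ∩ A).Nonempty ∧
    ∀ g : G, ∀ x ∈ O ∩ A, ∀ y ∈ O ∩ A, (g • x, g • y) ∈ ε}
  univ_sets := fun A hA => ⟨univ, isOpen_univ, by simpa using hA, fun _ _ _ _ _ => mem_univ _⟩
  sets_of_superset := by
    intro ε ε' h hsub A hA
    obtain ⟨O, hO, hne, hs⟩ := h A hA
    exact ⟨O, hO, hne, fun g x hx y hy => hsub (hs g x hx y hy)⟩
  inter_sets := by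
    intro ε ε' h h' A hA
    obtain ⟨O, hO, hne, hs⟩ := h A hA
    -- The second entourage is applied to the piece found for the first, which is possible because
    -- arbitrary subsets are allowed.
    obtain ⟨O', hO', hne', hs'⟩ := h' (O ∩ A) hne
    have hsub : (O ∩ O') ∩ A ⊆ O' ∩ (O ∩ A) := fun x hx => ⟨hx.1.2, hx.1.1, hx.2⟩
    refine ⟨O ∩ O', hO.inter hO', ?_, fun g x hx y hy =>
      ⟨hs g x ⟨hx.1.1, hx.2⟩ y ⟨hy.1.1, hy.2⟩, hs' g x (hsub hx) y (hsub hy)⟩⟩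
    obtain ⟨x, hx, hx', hxA⟩ := hne'
    exact ⟨x, ⟨hx', hx⟩, hxA⟩

theorem isFragmented_iff_le {Y : Type*} [UniformSpace Y] [MulAction G Y] :
    IsFragmented G Y ↔ fragmentationFilter G Y ≤ 𝓤 Y := Iff.rfl

/-- Fragmentedness is the form of HNS that passes to initial families: an arbitrary `A` is
fragmented by pulling back a small piece of its image, and finitely many factors are handled by
`fragmentationFilter`. -/
theorem stableUnderInitial_isHNS : StableUnderInitial.{u} G (fun Y _ _ => IsHNS G Y) := by
  intro ι Z _ _ _ Y _ _ _ π hπ hZ hY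
  refine IsFragmented.isHNS (isFragmented_iff_le.2 ?_)
  rw [hZ]
  refine le_iInf fun i => ?_
  rintro _ ⟨ε, hε, hsub⟩ A hA
  obtain ⟨O, hO, ⟨_, hzO, z, hz, rfl⟩, hs⟩ := (hY i).isFragmented ε hε (π i '' A) (hA.image _)
  refine ⟨π i ⁻¹' O, hO.preimage (continuous_of_uniformity_eq_iInf hZ i), ⟨z, hzO, hz⟩, ?_⟩
  rintro g x ⟨hx, hxA⟩ y ⟨hy, hyA⟩
  refine hsub ?_
  change (π i (g • x), π i (g • y)) ∈ ε
  rw [hπ, hπ]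
  exact hs g _ ⟨hx, mem_image_of_mem _ hxA⟩ _ ⟨hy, mem_image_of_mem _ hyA⟩

end Classes

/-! ### Functions coming from a class of systems form a G-subalgebra inside RUC. -/

section ComingFrom

variable {G : Type v} [Group G] [TopologicalSpace G]
variable {X : Type u} [TopologicalSpace X] [MulAction G X]
variable {P Q : ∀ (Y : Type u) [UniformSpace Y] [MulAction G Y], Prop}

theorem comingFrom_mono
    (h : ∀ (Y : Type u) [UniformSpace Y] [MulAction G Y] [ContinuousSMul G Y], P Y → Q Y) :
    comingFrom G X P ⊆ comingFrom G X Q := by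
  rintro f ⟨Y, _, _, ν, F, hν, hP, hF⟩
  have := hν.continuousSMul
  exact ⟨Y, _, _, ν, F, hν, h Y hP, hF⟩

/-- A family of functions that come from systems in the class `P` comes from a single system in
the class `P`. -/
theorem exists_common_compactification (hP : StableUnderInitial G P) {ι : Type} (f : ι → X →ᵇ ℝ)
    (hf : ∀ i, f i ∈ comingFrom G X P) :
    ∃ (Y : Type u) (_ : UniformSpace Y) (_ : MulAction G Y) (ν : X → Y),
      IsGCompactification G ν ∧ P Y ∧ ∀ i, ∃ F : C(Y, ℝ), ∀ x, f i x = F (ν x) := by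
  choose Y _ _ ν F hν hPY hF using hf
  have := fun i => (hν i).compact
  have := fun i => (hν i).t2
  have := fun i => (hν i).continuousSMul
  let N : X → ∀ i, Y i := fun x i => ν i x
  have hN : Continuous N := continuous_pi fun i => (hν i).continuous
  have hNs : ∀ (g : G) x, N (g • x) = g • N x := fun g x => funext fun i => (hν i).map_smul g x
  let Z : SubMulAction G (∀ i, Y i) :=
    { carrier := closure (range N)
      smul_mem' := fun g z hz => map_mem_closure (continuous_const_smul g) hz (by
        rintro _ ⟨x, rfl⟩
        exact ⟨g • x, hNs g x⟩) }
  have hmem : ∀ x, N x ∈ Z := fun x => subset_closure (mem_range_self x)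
  let ν' : X → Z := fun x => ⟨N x, hmem x⟩
  have hZsmul : ContinuousSMul G Z :=
    ⟨Continuous.subtype_mk (by fun_prop) _⟩
  have hν' : IsGCompactification G ν' :=
    { compact := isCompact_iff_compactSpace.1 (isClosed_closure (s := range N)).isCompact
      t2 := inferInstance
      continuousSMul := hZsmul
      continuous := hN.subtype_mk _
      denseRange := by
        intro z
        rw [IsInducing.subtypeVal.closure_eq_preimage_closure_image, mem_preimage, ← range_comp]
        exact z.2
      map_smul := fun g x => Subtype.ext (hNs g x) }
  refine ⟨Z, inferInstance, inferInstance, ν', hν', ?_, fun i => ?_⟩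
  · refine hP ι Z Y (fun i z => z.1 i) (fun i g z => rfl) ?_ hPY
    rw [uniformity_subtype, Pi.uniformity, comap_iInf]
    simp only [comap_comap]
    rfl
  · exact ⟨⟨fun z => F i (z.1 i),
      (F i).continuous.comp ((continuous_apply i).comp continuous_subtype_val)⟩, fun x => hF i x⟩

theorem LE_subset_SUC : LE G X ⊆ SUC G X :=
  comingFrom_mono fun _ _ _ _ h => IsLE.isSUC h

theorem Asp_subset_LE : Asp G X ⊆ LE G X :=
  comingFrom_mono fun _ _ _ _ h => (IsHNS.isFragmented h).isLE

variable [ContinuousConstSMul G X]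

/-- The functions that come from systems in a class that is stable under subsystems of products
form a `G`-subalgebra. -/
def comingFromSubalgebra (hP : StableUnderInitial G P) : GSubalgebra G X where
  carrier := comingFrom G X P
  mul_mem' := by
    intro a b ha hb
    obtain ⟨Y, _, _, ν, hν, hPY, hF⟩ := exists_common_compactification hP
      (fun i : Bool => if i then a else b) (by rintro (_ | _) <;> simpa)
    obtain ⟨F, hF'⟩ := hF true
    obtain ⟨H, hH'⟩ := hF false
    exact ⟨Y, _, _, ν, F * H, hν, hPY, fun x => by
      simpa using congrArg₂ (· * ·) (hF' x) (hH' x)⟩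
  add_mem' := by
    intro a b ha hb
    obtain ⟨Y, _, _, ν, hν, hPY, hF⟩ := exists_common_compactification hP
      (fun i : Bool => if i then a else b) (by rintro (_ | _) <;> simpa)
    obtain ⟨F, hF'⟩ := hF true
    obtain ⟨H, hH'⟩ := hF false
    exact ⟨Y, _, _, ν, F + H, hν, hPY, fun x => by
      simpa using congrArg₂ (· + ·) (hF' x) (hH' x)⟩
  algebraMap_mem' := by
    intro r
    obtain ⟨Y, _, _, ν, hν, hPY, -⟩ := exists_common_compactification (X := X) hP
      -- The empty family yields a subsystem of a point, so the class always contains a system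
      -- through which constants factor.
      (fun i : Empty => i.elim) (fun i => i.elim)
    exact ⟨Y, _, _, ν, ContinuousMap.const Y r, hν, hPY, fun x => by
      simp [Algebra.algebraMap_eq_smul_one]⟩
  isClosed' := by
    refine isClosed_of_closure_subset fun f hf => ?_
    obtain ⟨s, hs, hlim⟩ := mem_closure_iff_seq_limit.1 hf
    -- One system carries the whole sequence, and the functions coming from it are closed, being an
    -- isometric image of C(Y).
    obtain ⟨Y, _, _, ν, hν, hPY, hF⟩ := exists_common_compactification hP s hs
    choose F hF using hF
    have := hν.compact
    let ν' : C(X, Y) := ⟨ν, hν.continuous⟩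
    have hclosed : IsClosed (range (pullback ν')) :=
      (isometry_pullback (ν := ν') hν.denseRange).isClosedEmbedding.isClosed_range
    obtain ⟨H, rfl⟩ := hclosed.mem_of_tendsto hlim
      (Eventually.of_forall fun n => ⟨F n, BoundedContinuousFunction.ext fun x => (hF n x).symm⟩)
    exact ⟨Y, _, _, ν, H, hν, hPY, fun x => rfl⟩
  translate_mem' := by
    rintro f ⟨Y, _, _, ν, F, hν, hPY, hF⟩ g
    have := hν.continuousSMul
    exact ⟨Y, _, _, ν, ⟨fun y => F (g • y), by fun_prop⟩, hν, hPY, fun x => by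
      rw [translate_apply, hF, hν.map_smul]; rfl⟩

/-- On compact `Y`, joint continuity of F(gy) means norm continuity of the curried map G → C(Y), and
pullback is isometric. -/
theorem comingFrom_subset_RUC : comingFrom G X P ⊆ RUC G X := by
  rintro f ⟨Y, _, _, ν, F, hν, -, hF⟩
  have := hν.continuousSMul
  have := hν.compact
  let ν' : C(X, Y) := ⟨ν, hν.continuous⟩
  let c : C(G, C(Y, ℝ)) := ContinuousMap.curry ⟨fun p : G × Y => F (p.1 • p.2), by fun_prop⟩
  have h : (fun g : G => translate f g) = fun g => pullback ν' (c g) := by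
    funext g
    ext x
    rw [translate_apply, hF, hν.map_smul]
    rfl
  change Continuous fun g : G => translate f g
  rw [h]
  exact (isometry_pullback (ν := ν') hν.denseRange).continuous.comp c.continuous

end ComingFrom

/-- Here f(x) = F(x·ν(1)), so right translation of f is governed by SUC at the single point ν(1),
with u = g⁻¹k, and by uniform continuity of F. -/
theorem SUC_subset_LUC {G : Type v} [Group G] [TopologicalSpace G] [ContinuousMul G] :
    SUC G G ⊆ LUC G := by
  rintro f ⟨Y, _, _, ν, F, hν, hSUC, hF⟩
  have := hν.compact
  have huc : UniformContinuous F := CompactSpace.uniformContinuous_of_continuous F.continuous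
  have hf : ∀ x, f x = F (x • ν 1) := fun x => by rw [hF, ← hν.map_smul, smul_eq_mul, mul_one]
  refine Metric.continuous_iff'.2 ?_
  intro g η hη
  obtain ⟨U, hU, hs⟩ := hSUC (ν 1) _ (huc (Metric.dist_mem_uniformity (half_pos hη)))
  have hT : Tendsto (fun k : G => g⁻¹ * k) (𝓝 g) (𝓝 1) := by
    have : Continuous fun k : G => g⁻¹ * k := continuous_const_mul _
    simpa using this.tendsto g
  filter_upwards [hT hU] with k hk
  refine lt_of_le_of_lt ((BoundedContinuousFunction.dist_le (half_pos hη).le).2 fun x => ?_)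
    (half_lt_self hη)
  have h1 := hs (x * g) (g⁻¹ * k) hk
  rw [mul_assoc, mul_inv_cancel_left] at h1
  change dist (f (x * k)) (f (x * g)) ≤ η / 2
  rw [hf, hf]
  exact le_of_lt h1

/-! ### RUC, UC and AP as G-subalgebras. -/

section OrbitContinuous

variable {G X : Type*} [TopologicalSpace G] [TopologicalSpace X]

theorem dist_compContinuous_le (c : C(X, X)) (f h : X →ᵇ ℝ) :
    dist (f.compContinuous c) (h.compContinuous c) ≤ dist f h :=
  (BoundedContinuousFunction.dist_le dist_nonneg).2 fun x =>
    BoundedContinuousFunction.dist_coe_le_dist (f := f) (g := h) (c x)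

/-- The functions on which a family of substitutions acts norm continuously. -/
noncomputable def orbitContinuousSubalgebra (c : G → C(X, X)) : Subalgebra ℝ (X →ᵇ ℝ) where
  carrier := {f | Continuous fun g => f.compContinuous (c g)}
  mul_mem' := fun {a b} ha hb => Continuous.mul (f := fun g => a.compContinuous (c g))
    (g := fun g => b.compContinuous (c g)) ha hb
  add_mem' := fun {a b} ha hb => Continuous.add (f := fun g => a.compContinuous (c g))
    (g := fun g => b.compContinuous (c g)) ha hb
  algebraMap_mem' := fun r => continuous_const (y := algebraMap ℝ (X →ᵇ ℝ) r)

theorem isClosed_orbitContinuousSubalgebra (c : G → C(X, X)) :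
    IsClosed (orbitContinuousSubalgebra c : Set (X →ᵇ ℝ)) := by
  refine isClosed_of_closure_subset fun f hf => ?_
  refine continuous_of_uniform_approx_of_continuous fun u hu => ?_
  obtain ⟨ε, hε, hu⟩ := Metric.mem_uniformity_dist.1 hu
  obtain ⟨h, hh, hd⟩ := Metric.mem_closure_iff.1 hf ε hε
  exact ⟨fun g => h.compContinuous (c g), hh, fun g =>
    hu ((dist_compContinuous_le (c g) f h).trans_lt hd)⟩

end OrbitContinuous

section Translates

variable {G : Type v} [Group G] {X : Type u} [TopologicalSpace X] [MulAction G X]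
  [ContinuousConstSMul G X]

theorem translate_translate (f : X →ᵇ ℝ) (g k : G) :
    translate (translate f g) k = translate f (g * k) := by
  ext x
  simp [mul_smul]

theorem dist_translate_le (f h : X →ᵇ ℝ) (g : G) : dist (translate f g) (translate h g) ≤ dist f h :=
  dist_compContinuous_le _ f h

theorem continuous_translate (g : G) : Continuous fun f : X →ᵇ ℝ => translate f g :=
  BoundedContinuousFunction.continuous_compContinuous _

variable (G X)

/-- `RUC(X)` as a `G`-subalgebra. -/
noncomputable def rucSubalgebra [TopologicalSpace G] [ContinuousMul G] : GSubalgebra G X where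
  toSubalgebra := orbitContinuousSubalgebra fun g : G => ⟨fun x => g • x, continuous_const_smul g⟩
  isClosed' := isClosed_orbitContinuousSubalgebra _
  translate_mem' := by
    intro f hf g
    change Continuous fun k : G => translate (translate f g) k
    simp only [translate_translate]
    exact Continuous.comp (g := fun k : G => translate f k) hf (continuous_const_mul g)

/-- `UC(G)` as a `G`-subalgebra. -/
noncomputable def ucSubalgebra [TopologicalSpace G] [ContinuousMul G] : GSubalgebra G G where
  toSubalgebra := (rucSubalgebra G G).toSubalgebra ⊓
    orbitContinuousSubalgebra fun g : G => ⟨fun x => x * g, continuous_mul_const g⟩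
  isClosed' := (rucSubalgebra G G).isClosed'.inter (isClosed_orbitContinuousSubalgebra _)
  translate_mem' := by
    rintro f ⟨hf, hf'⟩ g
    refine ⟨(rucSubalgebra G G).translate_mem' f hf g, ?_⟩
    have h : ∀ k : G, (translate f g).compContinuous ⟨fun x => x * k, continuous_mul_const k⟩ =
        translate (f.compContinuous ⟨fun x => x * k, continuous_mul_const k⟩) g := fun k => by
      ext x
      simp [mul_assoc]
    change Continuous fun k : G =>
      (translate f g).compContinuous ⟨fun x => x * k, continuous_mul_const k⟩
    simp only [h]
    exact (continuous_translate g).comp hf'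

variable {G X}

theorem range_translate_translate_subset (f : X →ᵇ ℝ) (g : G) :
    (range fun k : G => translate (translate f g) k) ⊆ range fun k : G => translate f k := by
  rintro _ ⟨k, rfl⟩
  exact ⟨g * k, (translate_translate f g k).symm⟩

theorem mem_AP_of_subset {f : X →ᵇ ℝ} {K : Set (X →ᵇ ℝ)} (hK : IsCompact K)
    (h : ∀ g : G, translate f g ∈ K) : f ∈ AP G X :=
  hK.closure_of_subset (range_subset_iff.2 h)

theorem translate_mem_closure (f : X →ᵇ ℝ) (g : G) :
    translate f g ∈ closure (range fun k : G => translate f k) :=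
  subset_closure (mem_range_self g)

variable (G X)

/-- `AP(X)` as a `G`-subalgebra. -/
noncomputable def apSubalgebra : GSubalgebra G X where
  carrier := AP G X
  mul_mem' := fun {a b} (ha : IsCompact _) (hb : IsCompact _) =>
    mem_AP_of_subset ((ha.prod hb).image continuous_mul) fun g =>
      ⟨(translate a g, translate b g),
        ⟨translate_mem_closure a g, translate_mem_closure b g⟩, rfl⟩
  add_mem' := fun {a b} (ha : IsCompact _) (hb : IsCompact _) =>
    mem_AP_of_subset ((ha.prod hb).image continuous_add) fun g =>
      ⟨(translate a g, translate b g),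
        ⟨translate_mem_closure a g, translate_mem_closure b g⟩, rfl⟩
  algebraMap_mem' := fun r =>
    mem_AP_of_subset (isCompact_singleton (x := algebraMap ℝ (X →ᵇ ℝ) r)) fun g => rfl
  isClosed' := by
    refine isClosed_of_closure_subset fun f hf => ?_
    have htb : TotallyBounded (range fun g : G => translate f g) := by
      refine Metric.totallyBounded_iff.2 fun ε hε => ?_
      obtain ⟨h, hh, hd⟩ := Metric.mem_closure_iff.1 hf (ε / 2) (half_pos hε)
      obtain ⟨t, ht, hcov⟩ := Metric.totallyBounded_iff.1
        ((IsCompact.totallyBounded hh).subset subset_closure) (ε / 2) (half_pos hε)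
      refine ⟨t, ht, ?_⟩
      rintro _ ⟨g, rfl⟩
      obtain ⟨y, hy, hgy⟩ := mem_iUnion₂.1 (hcov (mem_range_self g))
      refine mem_iUnion₂.2 ⟨y, hy, ?_⟩
      rw [Metric.mem_ball] at hgy ⊢
      have h1 := dist_triangle (translate f g) (translate h g) y
      have h2 := dist_translate_le f h g
      linarith
    exact isCompact_iff_totallyBounded_isComplete.2 ⟨htb.closure, isClosed_closure.isComplete⟩
  translate_mem' := fun f (hf : IsCompact _) g =>
    hf.of_isClosed_subset isClosed_closure (closure_mono (range_translate_translate_subset f g))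

end Translates

/-! ### The weak topology on bounded functions and weak continuity of products. -/

section WeakTopology

variable {X : Type*} [TopologicalSpace X]

/-- The function underlying a point of the weak space of bounded functions. -/
noncomputable abbrev ofWeak (w : WeakSpace ℝ (X →ᵇ ℝ)) : X →ᵇ ℝ := (toWeakSpace ℝ (X →ᵇ ℝ)).symm w

theorem continuous_functional_ofWeak (φ : (X →ᵇ ℝ) →L[ℝ] ℝ) :
    Continuous fun w : WeakSpace ℝ (X →ᵇ ℝ) => φ (ofWeak w) :=
  WeakBilin.eval_continuous _ φ

theorem continuous_ofWeak_apply (x : X) :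
    Continuous fun w : WeakSpace ℝ (X →ᵇ ℝ) => ofWeak w x :=
  continuous_functional_ofWeak (BoundedContinuousFunction.evalCLM ℝ x)

theorem continuous_toWeakSpace_of_functional {Z : Type*} [TopologicalSpace Z] {c : Z → X →ᵇ ℝ}
    (h : ∀ φ : (X →ᵇ ℝ) →L[ℝ] ℝ, Continuous fun z => φ (c z)) :
    Continuous fun z => toWeakSpace ℝ (X →ᵇ ℝ) (c z) :=
  WeakBilin.continuous_of_continuous_eval _ h

/-- Evaluation at a point, as a character. -/
noncomputable def evalCharacter (x : X) : WeakDual.characterSpace ℝ (X →ᵇ ℝ) :=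
  ⟨StrongDual.toWeakDual (BoundedContinuousFunction.evalCLM ℝ x), by
    constructor
    · intro h
      have h1 : (1 : ℝ) = 0 := congrArg (fun ψ : WeakDual ℝ (X →ᵇ ℝ) => ψ 1) h
      exact one_ne_zero h1
    · intro a b
      rfl⟩

theorem continuous_character_apply (f : X →ᵇ ℝ) :
    Continuous fun t : WeakDual.characterSpace ℝ (X →ᵇ ℝ) => t f :=
  (WeakDual.eval_continuous f).comp continuous_subtype_val

theorem continuous_character_ofWeak (t : WeakDual.characterSpace ℝ (X →ᵇ ℝ)) :
    Continuous fun w : WeakSpace ℝ (X →ᵇ ℝ) => t (ofWeak w) :=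
  continuous_functional_ofWeak (WeakDual.toStrongDual t.1)

theorem continuous_evalCharacter : Continuous (evalCharacter (X := X)) := by
  refine Continuous.subtype_mk (WeakDual.continuous_of_continuous_eval fun f => ?_) _
  exact f.continuous

/-- Composition with a continuous map into a compact space, as a continuous linear map. -/
noncomputable def pullbackL {Y : Type*} [TopologicalSpace Y] [CompactSpace Y] (ν : C(X, Y)) :
    C(Y, ℝ) →L[ℝ] (X →ᵇ ℝ) :=
  LinearMap.mkContinuous
    { toFun := pullback ν
      map_add' := fun _ _ => rfl
      map_smul' := fun _ _ => rfl } 1 fun F => by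
    rw [one_mul]
    exact (BoundedContinuousFunction.norm_le (norm_nonneg F)).2 fun x => F.norm_coe_le_norm _

/-- Multiplication is jointly weakly continuous on bounded weakly compact sets of functions. -/
theorem continuous_mul_weak {K L : Set (WeakSpace ℝ (X →ᵇ ℝ))} (hK : IsCompact K)
    (hL : IsCompact L) {C : ℝ} (hKC : ∀ w ∈ K, ‖ofWeak w‖ ≤ C) (hLC : ∀ w ∈ L, ‖ofWeak w‖ ≤ C) :
    Continuous fun p : K × L => toWeakSpace ℝ (X →ᵇ ℝ) (ofWeak p.1.1 * ofWeak p.2.1) := by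
  have := isCompact_iff_compactSpace.1 hK
  have := isCompact_iff_compactSpace.1 hL
  refine continuous_toWeakSpace_of_functional fun φ => ?_
  -- X need not be compact, so Grothendieck's theorem is applied on the compact character space.
  -- Characters are multiplicative and weakly continuous, so products are continuous at every point
  -- of it; `φ` is transported there by restricting functions to X.
  let T := WeakDual.characterSpace ℝ (X →ᵇ ℝ)
  let c : K × L → C(T, ℝ) := fun p =>
    ⟨fun t => t (ofWeak p.1.1) * t (ofWeak p.2.1),
      (continuous_character_apply _).mul (continuous_character_apply _)⟩
  have hc : ∀ t : T, Continuous fun p => c p t := fun t =>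
    ((continuous_character_ofWeak t).comp (continuous_subtype_val.comp continuous_fst)).mul
      ((continuous_character_ofWeak t).comp (continuous_subtype_val.comp continuous_snd))
  have hbound : ∀ p, ‖c p‖ ≤ (‖(1 : X →ᵇ ℝ)‖ * C) * (‖(1 : X →ᵇ ℝ)‖ * C) := by
    intro p
    refine (ContinuousMap.norm_le _ (mul_self_nonneg _)).2 fun t => ?_
    change ‖t (ofWeak p.1.1) * t (ofWeak p.2.1)‖ ≤ _
    rw [norm_mul]
    have h1 := (abs_character_apply_le (X →ᵇ ℝ) t (ofWeak p.1.1)).trans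
      (mul_le_mul_of_nonneg_left (hKC _ p.1.2) (norm_nonneg _))
    have h2 := (abs_character_apply_le (X →ᵇ ℝ) t (ofWeak p.2.1)).trans
      (mul_le_mul_of_nonneg_left (hLC _ p.2.2) (norm_nonneg _))
    exact mul_le_mul h1 h2 (abs_nonneg _) ((abs_nonneg _).trans h1)
  exact continuous_of_forall_eval c hc hbound
    (φ.comp (pullbackL ⟨evalCharacter, continuous_evalCharacter⟩))

end WeakTopology

/-! ### WAP as a G-subalgebra, and its inclusion in RUC and Asp. -/

section WAP

variable {G : Type v} [Group G] {X : Type u} [TopologicalSpace X] [MulAction G X]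
  [ContinuousConstSMul G X]

/-- The weak closure of the orbit of a function. -/
def weakOrbitClosure (G : Type v) [Group G] [MulAction G X] [ContinuousConstSMul G X]
    (f : X →ᵇ ℝ) : Set (WeakSpace ℝ (X →ᵇ ℝ)) :=
  closure (toWeakSpace ℝ (X →ᵇ ℝ) '' range fun g : G => translate f g)

theorem translate_mem_weakOrbitClosure (f : X →ᵇ ℝ) (g : G) :
    toWeakSpace ℝ (X →ᵇ ℝ) (translate f g) ∈ weakOrbitClosure G f :=
  subset_closure (mem_image_of_mem _ (mem_range_self g))

theorem norm_le_of_mem_weakOrbitClosure {f : X →ᵇ ℝ} {w : WeakSpace ℝ (X →ᵇ ℝ)}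
    (hw : w ∈ weakOrbitClosure G f) : ‖ofWeak w‖ ≤ ‖f‖ := by
  refine (BoundedContinuousFunction.norm_le (norm_nonneg f)).2 fun x => ?_
  refine closure_minimal (t := {w | ‖ofWeak w x‖ ≤ ‖f‖}) ?_
    (isClosed_le (continuous_ofWeak_apply x).norm continuous_const) hw
  rintro _ ⟨_, ⟨g, rfl⟩, rfl⟩
  exact f.norm_coe_le_norm (g • x)

theorem mem_WAP_of_subset {f : X →ᵇ ℝ} {K : Set (WeakSpace ℝ (X →ᵇ ℝ))} (hK : IsCompact K)
    (h : ∀ g : G, toWeakSpace ℝ (X →ᵇ ℝ) (translate f g) ∈ K) : f ∈ WAP G X := by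
  refine hK.closure_of_subset ?_
  rintro _ ⟨_, ⟨g, rfl⟩, rfl⟩
  exact h g

theorem AP_subset_WAP : AP G X ⊆ WAP G X := fun f hf =>
  mem_WAP_of_subset (IsCompact.image hf (toWeakSpaceCLM ℝ (X →ᵇ ℝ)).continuous) fun g =>
    ⟨translate f g, translate_mem_closure f g, rfl⟩

theorem mul_mem_WAP {a b : X →ᵇ ℝ} (ha : a ∈ WAP G X) (hb : b ∈ WAP G X) :
    a * b ∈ WAP G X := by
  have hK : IsCompact (weakOrbitClosure G a) := ha
  have hL : IsCompact (weakOrbitClosure G b) := hb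
  have := isCompact_iff_compactSpace.1 hK
  have := isCompact_iff_compactSpace.1 hL
  have hcont := continuous_mul_weak hK hL (C := max ‖a‖ ‖b‖)
    (fun w hw => (norm_le_of_mem_weakOrbitClosure hw).trans (le_max_left _ _))
    (fun w hw => (norm_le_of_mem_weakOrbitClosure hw).trans (le_max_right _ _))
  exact mem_WAP_of_subset (isCompact_range hcont) fun g =>
    ⟨(⟨_, translate_mem_weakOrbitClosure a g⟩, ⟨_, translate_mem_weakOrbitClosure b g⟩), rfl⟩

/-- For s n → f, the sequences in the product of the weak orbit closures whose mutual distances are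
at most those of the `s n` form a compact set `C`. Each converges in norm, uniformly over `C`, so
taking limits is weakly continuous and its compact image contains the orbit of f. The distances are
bounded pointwise on X to make the condition weakly closed. -/
theorem isClosed_WAP : IsClosed (WAP G X) := by
  refine isClosed_of_closure_subset fun f hf => ?_
  obtain ⟨s, hs, hlim⟩ := mem_closure_iff_seq_limit.1 hf
  let C : Set (ℕ → WeakSpace ℝ (X →ᵇ ℝ)) :=
    {m : ℕ → WeakSpace ℝ (X →ᵇ ℝ) | (∀ n, m n ∈ weakOrbitClosure G (s n)) ∧
    ∀ n k x, dist (ofWeak (m n) x) (ofWeak (m k) x) ≤ dist (s n) (s k)}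
  have hC : IsCompact C := by
    refine (isCompact_univ_pi fun n => hs n).of_isClosed_subset ?_ fun m hm n _ => hm.1 n
    refine IsClosed.inter (s₁ := {m : ℕ → WeakSpace ℝ (X →ᵇ ℝ) |
        ∀ n, m n ∈ weakOrbitClosure G (s n)})
      (s₂ := {m : ℕ → WeakSpace ℝ (X →ᵇ ℝ) |
        ∀ n k x, dist (ofWeak (m n) x) (ofWeak (m k) x) ≤ dist (s n) (s k)}) ?_ ?_
    · simp only [ofPred_forall]
      exact isClosed_iInter fun n => isClosed_closure.preimage (continuous_apply n)
    · simp only [ofPred_forall]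
      refine isClosed_iInter fun n => isClosed_iInter fun k => isClosed_iInter fun x => ?_
      exact isClosed_le (((continuous_ofWeak_apply x).comp (continuous_apply n)).dist
        ((continuous_ofWeak_apply x).comp (continuous_apply k))) continuous_const
  have hdist : ∀ m ∈ C, ∀ n k, dist (ofWeak (m n)) (ofWeak (m k)) ≤ dist (s n) (s k) :=
    fun m hm n k => (BoundedContinuousFunction.dist_le dist_nonneg).2 (hm.2 n k)
  have hcauchy : ∀ m : C, ∃ l, Tendsto (fun n => ofWeak (m.1 n)) atTop (𝓝 l) := by
    intro m
    refine cauchySeq_tendsto_of_complete (Metric.cauchySeq_iff.2 fun ε hε => ?_)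
    obtain ⟨N, hN⟩ := Metric.cauchySeq_iff.1 hlim.cauchySeq ε hε
    exact ⟨N, fun n hn k hk => (hdist m.1 m.2 n k).trans_lt (hN n hn k hk)⟩
  choose l hl using hcauchy
  have hdl : ∀ (m : C) n, dist (ofWeak (m.1 n)) (l m) ≤ dist (s n) f := fun m n =>
    le_of_tendsto_of_tendsto (tendsto_const_nhds.dist (hl m)) (tendsto_const_nhds.dist hlim)
      (Eventually.of_forall fun k => hdist m.1 m.2 n k)
  have hcont : Continuous fun m : C => toWeakSpace ℝ (X →ᵇ ℝ) (l m) := by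
    refine continuous_toWeakSpace_of_functional fun φ => ?_
    have hunif : TendstoUniformly (fun n (m : C) => φ (ofWeak (m.1 n))) (fun m => φ (l m))
        atTop := by
      refine Metric.tendstoUniformly_iff.2 fun ε hε => ?_
      have h0 : Tendsto (fun n => ‖φ‖ * dist (s n) f) atTop (𝓝 0) := by
        simpa using (tendsto_iff_dist_tendsto_zero.1 hlim).const_mul ‖φ‖
      filter_upwards [h0.eventually_lt_const hε] with n hn m
      rw [dist_comm, dist_eq_norm, ← map_sub]
      refine ((φ.le_opNorm _).trans ?_).trans_lt hn
      rw [← dist_eq_norm]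
      exact mul_le_mul_of_nonneg_left (hdl m n) (norm_nonneg _)
    refine hunif.continuous (Frequently.of_forall fun n => ?_)
    exact (continuous_functional_ofWeak φ).comp
      ((continuous_apply n).comp continuous_subtype_val)
  have := isCompact_iff_compactSpace.1 hC
  refine mem_WAP_of_subset (isCompact_range hcont) fun g => ?_
  let m : C := ⟨fun n => toWeakSpace ℝ (X →ᵇ ℝ) (translate (s n) g),
    fun n => translate_mem_weakOrbitClosure (s n) g, fun n k x =>
      BoundedContinuousFunction.dist_coe_le_dist (f := s n) (g := s k) (g • x)⟩
  have hm : Tendsto (fun n => ofWeak (m.1 n)) atTop (𝓝 (translate f g)) :=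
    ((continuous_translate g).tendsto f).comp hlim
  exact ⟨m, congrArg (toWeakSpace ℝ (X →ᵇ ℝ)) (tendsto_nhds_unique (hl m) hm)⟩

variable (G X)

/-- `WAP(X)` as a `G`-subalgebra. -/
noncomputable def wapSubalgebra : GSubalgebra G X where
  carrier := WAP G X
  mul_mem' := mul_mem_WAP
  add_mem' := fun {a b} (ha : IsCompact (weakOrbitClosure G a))
      (hb : IsCompact (weakOrbitClosure G b)) =>
    mem_WAP_of_subset (K := (fun p : WeakSpace ℝ (X →ᵇ ℝ) × WeakSpace ℝ (X →ᵇ ℝ) => p.1 + p.2) ''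
      (weakOrbitClosure G a ×ˢ weakOrbitClosure G b))
      ((ha.prod hb).image continuous_add) fun g =>
      ⟨(toWeakSpace ℝ (X →ᵇ ℝ) (translate a g), toWeakSpace ℝ (X →ᵇ ℝ) (translate b g)),
        ⟨translate_mem_weakOrbitClosure a g, translate_mem_weakOrbitClosure b g⟩, rfl⟩
  algebraMap_mem' := fun r => AP_subset_WAP ((apSubalgebra G X).algebraMap_mem' r)
  isClosed' := isClosed_WAP
  translate_mem' := fun f (hf : IsCompact _) g =>
    hf.of_isClosed_subset isClosed_closure
      (closure_mono (image_mono (range_translate_translate_subset f g)))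

variable {G X}

/-- The orbit map of a weakly almost periodic function is norm continuous. -/
theorem WAP_subset_RUC {G : Type v} [Group G] [TopologicalSpace G] [ContinuousMul G]
    {X : Type u} [TopologicalSpace X] [MulAction G X] [ContinuousSMul G X] :
    WAP G X ⊆ RUC G X := by
  intro f hf
  let K := weakOrbitClosure G f
  have hK : IsCompact K := hf
  have := isCompact_iff_compactSpace.1 hK
  let j : G → K := fun g => ⟨_, translate_mem_weakOrbitClosure f g⟩
  have hj : Continuous j := by
    -- On the weakly compact `K` the weak topology is that of pointwise convergence on X, so only
    -- continuity of f(gx) in g is needed.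
    have hemb : IsClosedEmbedding fun (w : K) (x : X) => ofWeak w.1 x := by
      refine Continuous.isClosedEmbedding (continuous_pi fun x =>
        (continuous_ofWeak_apply x).comp continuous_subtype_val) fun w w' h => ?_
      exact Subtype.ext ((toWeakSpace ℝ (X →ᵇ ℝ)).symm.injective (DFunLike.coe_injective h))
    refine hemb.isInducing.continuous_iff.2 (continuous_pi fun x => ?_)
    change Continuous fun g : G => f (g • x)
    fun_prop
  refine Metric.continuous_iff'.2 fun k ε hε => ?_
  obtain ⟨O, hO, ⟨_, hgO, g₀, rfl⟩, hsmall⟩ := exists_isOpen_small_oscillation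
    (fun (w : K) (t : WeakDual.characterSpace ℝ (X →ᵇ ℝ)) => t (ofWeak w.1))
    (fun w => continuous_character_apply _)
    (fun t => (continuous_character_ofWeak t).comp continuous_subtype_val)
    (range_nonempty j) (half_pos hε)
  -- Fragmentation gives norm smallness only near some `g₀`. Translation is non-expanding, so right
  -- multiplication moves the estimate from `g₀` to `k`.
  have hT : Tendsto (fun k' : G => k' * (k⁻¹ * g₀)) (𝓝 k) (𝓝 g₀) := by
    have : Continuous fun k' : G => k' * (k⁻¹ * g₀) := continuous_mul_const _
    simpa using this.tendsto k
  filter_upwards [hT.eventually ((hO.preimage hj).mem_nhds hgO)] with k' hk'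
  have h1 : dist (translate f (k' * (k⁻¹ * g₀))) (translate f g₀) ≤ ε / 2 :=
    (BoundedContinuousFunction.dist_le (half_pos hε).le).2 fun x =>
      hsmall _ ⟨hk', mem_range_self _⟩ _ ⟨hgO, mem_range_self _⟩ (evalCharacter x)
  have h2 := dist_translate_le (translate f (k' * (k⁻¹ * g₀))) (translate f g₀) (g₀⁻¹ * k)
  rw [translate_translate, translate_translate] at h2
  have e1 : k' * (k⁻¹ * g₀) * (g₀⁻¹ * k) = k' := by group
  have e2 : g₀ * (g₀⁻¹ * k) = k := by group
  rw [e1, e2] at h2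
  exact (h2.trans h1).trans_lt (half_lt_self hε)

/-- The uniformity of the Gelfand space. -/
noncomputable abbrev GSubalgebra.gelfandUniformSpace (A : GSubalgebra G X) :
    UniformSpace A.Gelfand :=
  (UniformSpace.comap (fun (φ : A.Gelfand) (f : A.toSubalgebra) => φ f)
    inferInstance).replaceTopology A.isInducing_gelfand.eq_induced

/-- Mazur: a norm closed subspace is convex and hence weakly closed. Thus characters of A can be
evaluated on the weak orbit closure. -/
theorem GSubalgebra.ofWeak_mem_of_mem_weakOrbitClosure (A : GSubalgebra G X) {f : X →ᵇ ℝ}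
    (hf : f ∈ A.functions) {w : WeakSpace ℝ (X →ᵇ ℝ)} (hw : w ∈ weakOrbitClosure G f) :
    ofWeak w ∈ A.toSubalgebra := by
  have hconv : Convex ℝ (A.toSubalgebra : Set (X →ᵇ ℝ)) := A.toSubalgebra.toSubmodule.convex
  have hcl := hconv.toWeakSpace_closure (𝕜 := ℝ)
  rw [IsClosed.closure_eq (show IsClosed (A.toSubalgebra : Set (X →ᵇ ℝ)) from A.isClosed')] at hcl
  have hsub : (toWeakSpace ℝ (X →ᵇ ℝ) '' range fun g : G => translate f g) ⊆
      toWeakSpace ℝ (X →ᵇ ℝ) '' (A.toSubalgebra : Set (X →ᵇ ℝ)) := by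
    rintro _ ⟨_, ⟨g, rfl⟩, rfl⟩
    exact mem_image_of_mem _ (A.translate_mem' f hf g)
  have := closure_mono hsub hw
  rw [← hcl] at this
  obtain ⟨h, hh, rfl⟩ := this
  exact hh

/-- If `A` consists of weakly almost periodic functions, then `|A|` is fragmented. -/
theorem GSubalgebra.isFragmented_gelfand (A : GSubalgebra G X) (hA : A.functions ⊆ WAP G X) :
    @IsFragmented G _ A.Gelfand A.gelfandUniformSpace _ := by
  let _ := A.gelfandUniformSpace
  refine isFragmented_iff_le.2 ?_
  have hU : 𝓤 A.Gelfand = ⨅ f : A.toSubalgebra,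
      comap (Prod.map (fun φ : A.Gelfand => φ f) (fun φ : A.Gelfand => φ f)) (𝓤 ℝ) := by
    change comap _ (𝓤 (A.toSubalgebra → ℝ)) = _
    rw [Pi.uniformity, comap_iInf]
    simp only [comap_comap]
    rfl
  rw [hU]
  refine le_iInf fun f => ?_
  rintro _ ⟨V, hV, hsub⟩ B hB
  obtain ⟨ε, hε, hεV⟩ := Metric.mem_uniformity_dist.1 hV
  let K := weakOrbitClosure G f.1
  have hK : IsCompact K := hA f.2
  have := isCompact_iff_compactSpace.1 hK
  let r : K → A.toSubalgebra := fun w => ⟨_, A.ofWeak_mem_of_mem_weakOrbitClosure f.2 w.2⟩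
  obtain ⟨O, hO, hne, hsmall⟩ := exists_isOpen_small_oscillation
    (fun (φ : A.Gelfand) (w : K) => φ (r w)) (fun φ => by
      -- The weak topology on `K` comes from functionals on all of C(X), so φ is extended by
      -- Hahn–Banach to see that it is continuous on `K`.
      obtain ⟨ψ, hψ, -⟩ := exists_extension_norm_eq A.toSubalgebra.toSubmodule
        (WeakDual.toStrongDual φ.1)
      have h : (fun w : K => φ (r w)) = fun w : K => ψ (ofWeak w.1) := by
        funext w
        exact (hψ (r w)).symm
      rw [h]
      exact (continuous_functional_ofWeak ψ).comp continuous_subtype_val)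
    (fun w => A.continuous_eval (r w)) hB (half_pos hε)
  refine ⟨O, hO, hne, fun g φ hφ ψ hψ => hsub (hεV ?_)⟩
  refine lt_of_le_of_lt ?_ (half_lt_self hε)
  exact hsmall φ hφ ψ hψ ⟨_, translate_mem_weakOrbitClosure f.1 g⟩

theorem WAP_subset_Asp {G : Type v} [Group G] [TopologicalSpace G] [ContinuousMul G]
    {X : Type u} [TopologicalSpace X] [MulAction G X] [ContinuousSMul G X] :
    WAP G X ⊆ Asp G X := by
  intro f hf
  let A := wapSubalgebra G X
  let _ := A.gelfandUniformSpace
  exact ⟨A.Gelfand, A.gelfandUniformSpace, inferInstance, A.eva,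
    ⟨fun φ => φ ⟨f, hf⟩, A.continuous_eval ⟨f, hf⟩⟩, A.isGCompactification_eva WAP_subset_RUC,
    IsFragmented.isHNS (A.isFragmented_gelfand subset_rfl), fun x => rfl⟩

end WAP

end GSystem

/-! ### Assembly of the two chains. -/

theorem mainTheorem7 (G : Type v) [Group G] [TopologicalSpace G] [IsTopologicalGroup G]
    [T2Space G] :
    -- the chain for an arbitrary `G`-space `X`
    (∀ (X : Type u) [TopologicalSpace X] [T35Space X] [MulAction G X] [ContinuousSMul G X],
      ∃ ruc suc le asp wap ap : GSystem.GSubalgebra G X,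
        -- the six classes of functions are `G`-subalgebras
        (ruc.functions = GSystem.RUC G X ∧ suc.functions = GSystem.SUC G X ∧
          le.functions = GSystem.LE G X ∧ asp.functions = GSystem.Asp G X ∧
          wap.functions = GSystem.WAP G X ∧ ap.functions = GSystem.AP G X) ∧
        -- the inclusions
        (suc.functions ⊆ ruc.functions ∧ le.functions ⊆ suc.functions ∧
          asp.functions ⊆ le.functions ∧ wap.functions ⊆ asp.functions ∧
          ap.functions ⊆ wap.functions) ∧
        -- the Gelfand spaces are `G`-compactifications
        (GSystem.IsGCompactification G ruc.eva ∧ GSystem.IsGCompactification G suc.eva ∧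
          GSystem.IsGCompactification G le.eva ∧ GSystem.IsGCompactification G asp.eva ∧
          GSystem.IsGCompactification G wap.eva ∧ GSystem.IsGCompactification G ap.eva) ∧
        -- the factor maps
        (GSystem.HasGFactorMap ruc suc ∧ GSystem.HasGFactorMap suc le ∧
          GSystem.HasGFactorMap le asp ∧ GSystem.HasGFactorMap asp wap ∧
          GSystem.HasGFactorMap wap ap)) ∧
    -- the chain for `X = G` with the action by left multiplication
    (∃ ruc uc suc le asp wap ap : GSystem.GSubalgebra G G,
        (ruc.functions = GSystem.RUC G G ∧ uc.functions = GSystem.UC G ∧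
          suc.functions = GSystem.SUC G G ∧ le.functions = GSystem.LE G G ∧
          asp.functions = GSystem.Asp G G ∧ wap.functions = GSystem.WAP G G ∧
          ap.functions = GSystem.AP G G) ∧
        (uc.functions ⊆ ruc.functions ∧ suc.functions ⊆ uc.functions ∧
          le.functions ⊆ suc.functions ∧ asp.functions ⊆ le.functions ∧
          wap.functions ⊆ asp.functions ∧ ap.functions ⊆ wap.functions) ∧
        (GSystem.IsGCompactification G ruc.eva ∧ GSystem.IsGCompactification G uc.eva ∧
          GSystem.IsGCompactification G suc.eva ∧ GSystem.IsGCompactification G le.eva ∧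
          GSystem.IsGCompactification G asp.eva ∧ GSystem.IsGCompactification G wap.eva ∧
          GSystem.IsGCompactification G ap.eva) ∧
        (GSystem.HasGFactorMap ruc uc ∧ GSystem.HasGFactorMap uc suc ∧
          GSystem.HasGFactorMap suc le ∧ GSystem.HasGFactorMap le asp ∧
          GSystem.HasGFactorMap asp wap ∧ GSystem.HasGFactorMap wap ap)) := by
  refine ⟨fun X _ _ _ _ => ?_, ?_⟩
  · have h0 : GSystem.RUC G X ⊆ GSystem.RUC G X := subset_rfl
    have h1 : GSystem.SUC G X ⊆ GSystem.RUC G X := GSystem.comingFrom_subset_RUC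
    have h2 : GSystem.LE G X ⊆ GSystem.SUC G X := GSystem.LE_subset_SUC
    have h3 : GSystem.Asp G X ⊆ GSystem.LE G X := GSystem.Asp_subset_LE
    have h4 : GSystem.WAP G X ⊆ GSystem.Asp G X := GSystem.WAP_subset_Asp
    have h5 : GSystem.AP G X ⊆ GSystem.WAP G X := GSystem.AP_subset_WAP
    have k2 := h2.trans h1
    have k3 := h3.trans k2
    have k4 := h4.trans k3
    have k5 := h5.trans k4
    exact ⟨GSystem.rucSubalgebra G X,
      GSystem.comingFromSubalgebra GSystem.stableUnderInitial_isSUC,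
      GSystem.comingFromSubalgebra GSystem.stableUnderInitial_isLE,
      GSystem.comingFromSubalgebra GSystem.stableUnderInitial_isHNS,
      GSystem.wapSubalgebra G X, GSystem.apSubalgebra G X,
      ⟨rfl, rfl, rfl, rfl, rfl, rfl⟩, ⟨h1, h2, h3, h4, h5⟩,
      ⟨GSystem.GSubalgebra.isGCompactification_eva _ h0,
        GSystem.GSubalgebra.isGCompactification_eva _ h1,
        GSystem.GSubalgebra.isGCompactification_eva _ k2,
        GSystem.GSubalgebra.isGCompactification_eva _ k3,
        GSystem.GSubalgebra.isGCompactification_eva _ k4,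
        GSystem.GSubalgebra.isGCompactification_eva _ k5⟩,
      ⟨GSystem.GSubalgebra.hasGFactorMap h1, GSystem.GSubalgebra.hasGFactorMap h2,
        GSystem.GSubalgebra.hasGFactorMap h3, GSystem.GSubalgebra.hasGFactorMap h4,
        GSystem.GSubalgebra.hasGFactorMap h5⟩⟩
  · have h0 : GSystem.RUC G G ⊆ GSystem.RUC G G := subset_rfl
    have h1 : GSystem.UC G ⊆ GSystem.RUC G G := inter_subset_left
    have h1' : GSystem.SUC G G ⊆ GSystem.UC G :=
      subset_inter GSystem.comingFrom_subset_RUC GSystem.SUC_subset_LUC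
    have h2 : GSystem.LE G G ⊆ GSystem.SUC G G := GSystem.LE_subset_SUC
    have h3 : GSystem.Asp G G ⊆ GSystem.LE G G := GSystem.Asp_subset_LE
    have h4 : GSystem.WAP G G ⊆ GSystem.Asp G G := GSystem.WAP_subset_Asp
    have h5 : GSystem.AP G G ⊆ GSystem.WAP G G := GSystem.AP_subset_WAP
    have k1 := h1'.trans h1
    have k2 := h2.trans k1
    have k3 := h3.trans k2
    have k4 := h4.trans k3
    have k5 := h5.trans k4
    exact ⟨GSystem.rucSubalgebra G G, GSystem.ucSubalgebra G,
      GSystem.comingFromSubalgebra GSystem.stableUnderInitial_isSUC,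
      GSystem.comingFromSubalgebra GSystem.stableUnderInitial_isLE,
      GSystem.comingFromSubalgebra GSystem.stableUnderInitial_isHNS,
      GSystem.wapSubalgebra G G, GSystem.apSubalgebra G G,
      ⟨rfl, rfl, rfl, rfl, rfl, rfl, rfl⟩, ⟨h1, h1', h2, h3, h4, h5⟩,
      ⟨GSystem.GSubalgebra.isGCompactification_eva _ h0,
        GSystem.GSubalgebra.isGCompactification_eva _ h1,
        GSystem.GSubalgebra.isGCompactification_eva _ k1,
        GSystem.GSubalgebra.isGCompactification_eva _ k2,
        GSystem.GSubalgebra.isGCompactification_eva _ k3,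
        GSystem.GSubalgebra.isGCompactification_eva _ k4,
        GSystem.GSubalgebra.isGCompactification_eva _ k5⟩,
      ⟨GSystem.GSubalgebra.hasGFactorMap h1, GSystem.GSubalgebra.hasGFactorMap h1',
        GSystem.GSubalgebra.hasGFactorMap h2, GSystem.GSubalgebra.hasGFactorMap h3,
        GSystem.GSubalgebra.hasGFactorMap h4, GSystem.GSubalgebra.hasGFactorMap h5⟩⟩
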